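/- Let $k$ be a field, $R$ a commutative $k$-algebra, $S=\operatorname{Spec} R$, and let $G=\operatorname{Spec}\mathcal O(G)$ be an affine $k$-groupoid scheme acting on $S$, with source and target $s,t\colon G\to S$ (composition $gh$ being defined when $s(g)=t(h)$), given by the Hopf algebroid $\mathcal O(G)$ over $R$ with coproduct $\Delta$, counit $\varepsilon$ and antipode $\iota$. Assume that $G$ acts transitively on $S$: for every $k$-scheme $T$ and every pair of morphisms $a,b\colon T\to S$ there are a faithfully flat quasi-compact $W\to T$ and a morphism $W\to G$ with source $a|_W$ and target $b|_W$. A representation of $G$ is an $R$-module $V$ with a counital coassociative coaction $\rho\colon V\to V\otimes_{R,t}\mathcal O(G)$ satisfying $\rho(rv)=\rho(v)\,s(r)$; a sequence of representations is exact if it is exact as a sequence of $R$-modules. Let $G^\Delta=G\times_{S\times_k S}S$ be the diagonal group scheme, with $\pi\colon\mathcal O(G)\to\mathcal O(G^\Delta)=\mathcal O(G)/(s(r)-t(r) : r\in R)$. For a representation $W$ of $G^\Delta$, let $\operatorname{Ind}_{G^\Delta}^G(W)=(W\otimes_{R,t}\mathcal O(G))^{G^\Delta}$ be the invariants of the coaction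 $w\otimes g\mapsto\sum w_{(0)}\otimes w_{(1)}\,\iota(\pi(g_{(1)}))\otimes g_{(2)}$ of $\mathcal O(G^\Delta)$, with $R$-module structure $r\cdot(w\otimes g)=w\otimes s(r)g$ and with the coaction of $\mathcal O(G)$ induced by $\mathrm{id}_W\otimes\Delta$; on morphisms, $\operatorname{Ind}_{G^\Delta}^G(f)$ is the restriction of $f\otimes\mathrm{id}$. Then $s$ and $t$ are flat (so that $\operatorname{Ind}_{G^\Delta}^G$ is a well-defined functor from representations of $G^\Delta$ to representations of $G$), and $\operatorname{Ind}_{G^\Delta}^G$ is faithfully exact: it is faithful, and a sequence $W'\to W\to W''$ of representations of $G^\Delta$ is exact if and only if the induced sequence $\operatorname{Ind}_{G^\Delta}^G(W')\to\operatorname{Ind}_{G^\Delta}^G(W)\to\operatorname{Ind}_{G^\Delta}^G(W'')$ is exact. Moreover, for every representation $W$ of $G^\Delta$, the canonical morphism of $G^\Delta$-representations $$\operatorname{Ind}_{G^\Delta}^G(W)\longrightarrow W,\qquad w\otimes g\longmapsto \varepsilon(g)\,w,$$ is surjective. -/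

import Mathlib

open CategoryTheory TensorProduct

universe u

/-- A commutative ring `C` regarded as an algebra over `R` through the ring map `f : R → C`.
The same ring can thus carry several `R`-algebra structures. -/
def Along {R C : Type u} [CommRing R] [CommRing C] (_f : R →+* C) : Type u := C

namespace Along

variable {R C C' : Type u} [CommRing R] [CommRing C] [CommRing C']

instance (f : R →+* C) : CommRing (Along f) := inferInstanceAs (CommRing C)

instance (f : R →+* C) : Algebra R (Along f) := f.toAlgebra

instance (f : R →+* C) : Algebra C (Along f) := Algebra.id C

/-- The identity map of `C`. -/
def of (f : R →+* C) : C →+* Along f := RingHom.id C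

/-- The identity map of `C`, backwards. -/
def out (f : R →+* C) : Along f →+* C := RingHom.id C

theorem out_of (f : R →+* C) (c : C) : out f (of f c) = c := rfl

theorem of_out (f : R →+* C) (c : Along f) : of f (out f c) = c := rfl

theorem smul_of (f : R →+* C) (r : R) (c : C) : r • of f c = of f (f r * c) := rfl

theorem smul_of' (f : R →+* C) (d c : C) : d • of f c = of f (d * c) := rfl

instance (f : R →+* C) : SMulCommClass R C (Along f) :=
  ⟨fun r d c => mul_left_comm (f r) d (out f c)⟩

/-- A ring map `x : C → C'` with `x ∘ f = f'` is a map of `R`-algebras. -/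
def map (x : C →+* C') {f : R →+* C} {f' : R →+* C'} (h : x.comp f = f') :
    Along f →ₐ[R] Along f' where
  toRingHom := ((of f').comp x).comp (out f)
  commutes' r := show x (f r) = f' r by rw [← h]; rfl

theorem map_of (x : C →+* C') {f : R →+* C} {f' : R →+* C'} (h : x.comp f = f') (c : C) :
    map x h (of f c) = of f' (x c) := rfl

end Along

/-- The ring `P ⊗_R Q` for two ring maps `p : R → P` and `q : R → Q`; its spectrum is the fibre
product of `Spec P` and `Spec Q` over `Spec R`. -/
abbrev Fib {R P Q : Type u} [CommRing R] [CommRing P] [CommRing Q] (p : R →+* P) (q : R →+* Q) :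
    Type u := Along p ⊗[R] Along q

namespace Fib

variable {R P Q C C' : Type u} [CommRing R] [CommRing P] [CommRing Q] [CommRing C] [CommRing C']
  (p : R →+* P) (q : R →+* Q)

/-- `a ↦ a ⊗ 1`. -/
def inl : P →+* Fib p q := (Algebra.TensorProduct.includeLeftRingHom).comp (Along.of p)

/-- `b ↦ 1 ⊗ b`. -/
def inr : Q →+* Fib p q :=
  (Algebra.TensorProduct.includeRight (R := R) (A := Along p) (B := Along q)).toRingHom.comp
    (Along.of q)

theorem inl_apply (a : P) : inl p q a = Along.of p a ⊗ₜ[R] 1 := rfl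

theorem inr_apply (b : Q) : inr p q b = 1 ⊗ₜ[R] Along.of q b := rfl

theorem inl_comp : (inl p q).comp p = (inr p q).comp q := by
  ext r
  have h1 : Along.of p (p r) = r • (1 : Along p) := by
    rw [← map_one (Along.of p), Along.smul_of, mul_one]
  have h2 : Along.of q (q r) = r • (1 : Along q) := by
    rw [← map_one (Along.of q), Along.smul_of, mul_one]
  simp only [RingHom.comp_apply, inl_apply, inr_apply, h1, h2, TensorProduct.smul_tmul]

variable {p q}

/-- The ring map `a ⊗ b ↦ x(a) y(b)`. -/
def lift (x : P →+* C) (y : Q →+* C) (h : x.comp p = y.comp q) : Fib p q →+* C :=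
  (Along.out (x.comp p)).comp
    (Algebra.TensorProduct.productMap (Along.map x rfl : Along p →ₐ[R] Along (x.comp p))
      (Along.map y h.symm : Along q →ₐ[R] Along (x.comp p))).toRingHom

theorem lift_tmul (x : P →+* C) (y : Q →+* C) (h : x.comp p = y.comp q) (a : P) (b : Q) :
    lift x y h (Along.of p a ⊗ₜ Along.of q b) = x a * y b := by
  have := Algebra.TensorProduct.productMap_apply_tmul
    (Along.map x rfl : Along p →ₐ[R] Along (x.comp p))
    (Along.map y h.symm : Along q →ₐ[R] Along (x.comp p)) (Along.of p a) (Along.of q b)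
  exact this

theorem lift_inl (x : P →+* C) (y : Q →+* C) (h : x.comp p = y.comp q) :
    (lift x y h).comp (inl p q) = x := by
  ext a
  have := lift_tmul x y h a 1
  rw [map_one, map_one, mul_one] at this
  exact this

theorem lift_inr (x : P →+* C) (y : Q →+* C) (h : x.comp p = y.comp q) :
    (lift x y h).comp (inr p q) = y := by
  ext a
  have := lift_tmul x y h 1 a
  rw [map_one, map_one, one_mul] at this
  exact this

theorem tmul_eq (a : P) (b : Q) :
    Along.of p a ⊗ₜ[R] Along.of q b = inl p q a * inr p q b := by
  rw [inl_apply, inr_apply, Algebra.TensorProduct.tmul_mul_tmul, mul_one, one_mul]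

theorem hom_ext {x y : Fib p q →+* C} (hl : x.comp (inl p q) = y.comp (inl p q))
    (hr : x.comp (inr p q) = y.comp (inr p q)) : x = y := by
  refine RingHom.ext fun z => ?_
  induction z using TensorProduct.induction_on with
  | zero => simp
  | add a b ha hb => rw [map_add, map_add, ha, hb]
  | tmul a b =>
    have h1 := RingHom.congr_fun hl (Along.out p a)
    have h2 := RingHom.congr_fun hr (Along.out q b)
    have h3 : a ⊗ₜ[R] b = inl p q (Along.out p a) * inr p q (Along.out q b) :=
      tmul_eq (Along.out p a) (Along.out q b)
    rw [h3, map_mul, map_mul]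
    exact congrArg₂ (· * ·) h1 h2

theorem comp_lift (f : C →+* C') (x : P →+* C) (y : Q →+* C) (h : x.comp p = y.comp q)
    (h' : (f.comp x).comp p = (f.comp y).comp q) :
    f.comp (lift x y h) = lift (f.comp x) (f.comp y) h' := by
  apply hom_ext
  · rw [RingHom.comp_assoc, lift_inl, lift_inl]
  · rw [RingHom.comp_assoc, lift_inr, lift_inr]

end Fib

/-- The scheme-theoretic source, target and composition of an affine groupoid over `Spec R`
with coordinate ring `A`, before any groupoid law is imposed. The composition `g h` of two
points is defined when the source of `g` is the target of `h`; dually, the coproduct goes to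
`A ⊗_R A` where the left factor is an `R`-module through `s` and the right one through `t`. -/
structure PreGroupoid (k R A : Type u) [CommRing k] [CommRing R] [CommRing A] [Algebra k R]
    [Algebra k A] where
  s : R →+* A
  t : R →+* A
  s_algebraMap : s.comp (algebraMap k R) = algebraMap k A
  t_algebraMap : t.comp (algebraMap k R) = algebraMap k A
  Δ : A →+* Fib s t
  Δ_s : Δ.comp s = (Fib.inr s t).comp s
  Δ_t : Δ.comp t = (Fib.inl s t).comp t

namespace PreGroupoid

variable {k R A C C' : Type u} [CommRing k] [CommRing R] [CommRing A] [Algebra k R]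
  [Algebra k A] [CommRing C] [CommRing C'] (G : PreGroupoid k R A)

/-- The composition `x y` of two `C`-valued points such that the source of `x` is the target
of `y`. -/
def conv (x y : A →+* C) (h : x.comp G.s = y.comp G.t) : A →+* C := (Fib.lift x y h).comp G.Δ

theorem conv_s (x y : A →+* C) (h : x.comp G.s = y.comp G.t) :
    (G.conv x y h).comp G.s = y.comp G.s := by
  rw [conv, RingHom.comp_assoc, G.Δ_s, ← RingHom.comp_assoc, Fib.lift_inr]

theorem conv_t (x y : A →+* C) (h : x.comp G.s = y.comp G.t) :
    (G.conv x y h).comp G.t = x.comp G.t := by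
  rw [conv, RingHom.comp_assoc, G.Δ_t, ← RingHom.comp_assoc, Fib.lift_inl]

theorem comp_conv (f : C →+* C') (x y : A →+* C) (h : x.comp G.s = y.comp G.t)
    (h' : (f.comp x).comp G.s = (f.comp y).comp G.t) :
    f.comp (G.conv x y h) = G.conv (f.comp x) (f.comp y) h' := by
  rw [conv, ← RingHom.comp_assoc, Fib.comp_lift f x y h h', conv]

theorem conv_congr {x y x' y' : A →+* C} (hx : x = x') (hy : y = y')
    (h : x.comp G.s = y.comp G.t) (h' : x'.comp G.s = y'.comp G.t) :
    G.conv x y h = G.conv x' y' h' := by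
  subst hx; subst hy; rfl

theorem conv_comp_of {D : Type u} [CommRing D] [Algebra k D] (H : PreGroupoid k R D)
    (π : A →+* D)
    (hc : ((Fib.inl H.s H.t).comp π).comp G.s = ((Fib.inr H.s H.t).comp π).comp G.t)
    (hΔ : H.Δ.comp π = G.conv ((Fib.inl H.s H.t).comp π) ((Fib.inr H.s H.t).comp π) hc)
    (x y : D →+* C) (h : x.comp H.s = y.comp H.t)
    (h' : (x.comp π).comp G.s = (y.comp π).comp G.t) :
    (H.conv x y h).comp π = G.conv (x.comp π) (y.comp π) h' := by
  have e1 : (Fib.lift x y h).comp ((Fib.inl H.s H.t).comp π) = x.comp π := by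
    rw [← RingHom.comp_assoc, Fib.lift_inl]
  have e2 : (Fib.lift x y h).comp ((Fib.inr H.s H.t).comp π) = y.comp π := by
    rw [← RingHom.comp_assoc, Fib.lift_inr]
  rw [conv, RingHom.comp_assoc, hΔ, G.comp_conv (h' := by rw [e1, e2]; exact h')]
  exact G.conv_congr e1 e2 _ _

end PreGroupoid

/-- An affine `k`-groupoid scheme `Spec A` acting on `Spec R`, given by the Hopf algebroid
structure of its coordinate ring. The laws are expressed through the composition of points;
associativity for all points amounts to coassociativity of `Δ`. -/
structure AffineGroupoid (k R A : Type u) [CommRing k] [CommRing R] [CommRing A] [Algebra k R]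
    [Algebra k A] extends PreGroupoid k R A where
  conv_assoc : ∀ {C : Type u} [CommRing C] (x y z : A →+* C) (hxy : x.comp s = y.comp t)
    (hyz : y.comp s = z.comp t),
    toPreGroupoid.conv (toPreGroupoid.conv x y hxy) z
        ((toPreGroupoid.conv_s x y hxy).trans hyz) =
      toPreGroupoid.conv x (toPreGroupoid.conv y z hyz)
        (hxy.trans (toPreGroupoid.conv_t y z hyz).symm)
  ε : A →+* R
  ε_s : ε.comp s = RingHom.id R
  ε_t : ε.comp t = RingHom.id R
  one_conv : toPreGroupoid.conv (t.comp ε) (RingHom.id A)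
    (by rw [RingHom.comp_assoc, ε_s]; rfl) = RingHom.id A
  conv_one : toPreGroupoid.conv (RingHom.id A) (s.comp ε)
    (by rw [RingHom.comp_assoc, ε_t]; rfl) = RingHom.id A
  ι : A →+* A
  ι_s : ι.comp s = t
  ι_t : ι.comp t = s
  inv_conv : toPreGroupoid.conv ι (RingHom.id A) (by rw [ι_s]; rfl) = s.comp ε
  conv_inv : toPreGroupoid.conv (RingHom.id A) ι (by rw [ι_t]; rfl) = t.comp ε

namespace AffineGroupoid

section Basic

variable {k R A : Type u} [CommRing k] [CommRing R] [CommRing A] [Algebra k R] [Algebra k A]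
  (G : AffineGroupoid k R A)

/-- The source and target morphisms are flat. -/
def IsFlat : Prop := G.s.Flat ∧ G.t.Flat

/-- Any two `T`-valued points `a`, `b` of `Spec R` are joined by a point of the groupoid after a
faithfully flat quasi-compact base change `T → W`. -/
def IsTransitive : Prop :=
  ∀ (T : Type u) [CommRing T] [Algebra k T] (a b : R →ₐ[k] T),
    ∃ (W : Type u) (_ : CommRing W) (φ : T →+* W) (g : A →+* W), φ.FaithfullyFlat ∧
      g.comp G.s = φ.comp (a : R →+* T) ∧ g.comp G.t = φ.comp (b : R →+* T)

/-- The ideal of the closed subscheme of `Spec A` on which source and target agree. -/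
def diagIdeal : Ideal A := Ideal.span (Set.range fun r => G.s r - G.t r)

/-- The coordinate ring `A ⊗_{R ⊗ R} R = A / (s(r) - t(r))` of the diagonal group scheme. -/
abbrev DiagRing : Type u := A ⧸ G.diagIdeal

/-- The quotient map `A → O(G^Δ)`. -/
def π : A →+* G.DiagRing := Ideal.Quotient.mk G.diagIdeal

theorem π_s : G.π.comp G.s = G.π.comp G.t := by
  ext r
  exact Ideal.Quotient.eq.mpr (Ideal.subset_span ⟨r, rfl⟩)

/-- A point of `G` with equal source and target is a point of the diagonal. -/
def diagLift {C : Type u} [CommRing C] (x : A →+* C) (h : x.comp G.s = x.comp G.t) :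
    G.DiagRing →+* C :=
  Ideal.Quotient.lift G.diagIdeal x (by
    intro a ha
    have : G.diagIdeal ≤ RingHom.ker x := by
      refine Ideal.span_le.mpr ?_
      rintro _ ⟨r, rfl⟩
      have := RingHom.congr_fun h r
      simp only [RingHom.comp_apply] at this
      simp [RingHom.mem_ker, this]
    exact this ha)

theorem diagLift_π {C : Type u} [CommRing C] (x : A →+* C) (h : x.comp G.s = x.comp G.t) :
    (G.diagLift x h).comp G.π = x := by
  ext a; rfl

theorem diag_ext {C : Type u} [CommRing C] {x y : G.DiagRing →+* C}
    (h : x.comp G.π = y.comp G.π) : x = y := Ideal.Quotient.ringHom_ext h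

/-- The coproduct of `O(G^Δ)`, induced by that of `O(G)`. -/
def diagΔ : G.DiagRing →+* Fib (G.π.comp G.s) (G.π.comp G.t) :=
  G.diagLift
    (G.conv ((Fib.inl (G.π.comp G.s) (G.π.comp G.t)).comp G.π)
      ((Fib.inr (G.π.comp G.s) (G.π.comp G.t)).comp G.π)
      (Fib.inl_comp (G.π.comp G.s) (G.π.comp G.t)))
    (by
      rw [G.conv_s, G.conv_t, RingHom.comp_assoc, RingHom.comp_assoc, ← G.π_s]
      have h := Fib.inl_comp (G.π.comp G.s) (G.π.comp G.s)
      exact h.symm)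

theorem diagΔ_π : G.diagΔ.comp G.π =
    G.conv ((Fib.inl (G.π.comp G.s) (G.π.comp G.t)).comp G.π)
      ((Fib.inr (G.π.comp G.s) (G.π.comp G.t)).comp G.π)
      (Fib.inl_comp (G.π.comp G.s) (G.π.comp G.t)) := G.diagLift_π _ _

/-- Source, target and composition of the diagonal group scheme. -/
def diagPre : PreGroupoid k R G.DiagRing where
  s := G.π.comp G.s
  t := G.π.comp G.t
  s_algebraMap := by rw [RingHom.comp_assoc, G.s_algebraMap]; rfl
  t_algebraMap := by rw [RingHom.comp_assoc, G.t_algebraMap]; rfl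
  Δ := G.diagΔ
  Δ_s := by rw [← RingHom.comp_assoc, diagΔ_π, G.conv_s, RingHom.comp_assoc]
  Δ_t := by rw [← RingHom.comp_assoc, diagΔ_π, G.conv_t, RingHom.comp_assoc]

theorem diag_conv_π {C : Type u} [CommRing C] (x y : G.DiagRing →+* C)
    (h : x.comp G.diagPre.s = y.comp G.diagPre.t)
    (h' : (x.comp G.π).comp G.s = (y.comp G.π).comp G.t) :
    (G.diagPre.conv x y h).comp G.π = G.conv (x.comp G.π) (y.comp G.π) h' :=
  PreGroupoid.conv_comp_of G.toPreGroupoid G.diagPre G.π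
    (Fib.inl_comp (G.π.comp G.s) (G.π.comp G.t)) G.diagΔ_π x y h h'

theorem diag_ε_aux : G.ε.comp G.s = G.ε.comp G.t := by rw [G.ε_s, G.ε_t]

/-- The counit of `O(G^Δ)`. -/
def diagε : G.DiagRing →+* R := G.diagLift G.ε G.diag_ε_aux

theorem diagε_π : G.diagε.comp G.π = G.ε := G.diagLift_π _ _

theorem diag_ι_aux : (G.π.comp G.ι).comp G.s = (G.π.comp G.ι).comp G.t := by
  rw [RingHom.comp_assoc, G.ι_s, RingHom.comp_assoc, G.ι_t, G.π_s]

/-- The antipode of `O(G^Δ)`. -/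
def diagι : G.DiagRing →+* G.DiagRing := G.diagLift (G.π.comp G.ι) G.diag_ι_aux

theorem diagι_π : G.diagι.comp G.π = G.π.comp G.ι := G.diagLift_π _ _

/-- The diagonal group scheme `G^Δ` of `G`: the pullback of `G` along the diagonal of `Spec R`,
as a groupoid scheme whose source and target coincide. -/
def diag : AffineGroupoid k R G.DiagRing where
  toPreGroupoid := G.diagPre
  conv_assoc x y z hxy hyz := G.diag_ext <| by
    have hxy' : (x.comp G.π).comp G.s = (y.comp G.π).comp G.t := hxy
    have hyz' : (y.comp G.π).comp G.s = (z.comp G.π).comp G.t := hyz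
    have a1 := G.diag_conv_π x y hxy hxy'
    have a2 := G.diag_conv_π y z hyz hyz'
    refine (G.diag_conv_π _ z _ ?_).trans ((G.conv_congr a1 rfl _ ?_).trans
      ((G.conv_assoc (x.comp G.π) (y.comp G.π) (z.comp G.π) hxy' hyz').trans
      ((G.conv_congr rfl a2.symm _ ?_).trans (G.diag_conv_π x _ _ ?_).symm)))
    · rw [a1, G.conv_s]; exact hyz'
    · rw [G.conv_s]; exact hyz'
    · rw [a2, G.conv_t]; exact hxy'
    · rw [a2, G.conv_t]; exact hxy'
  ε := G.diagε
  ε_s := (congrArg (fun f => f.comp G.s) G.diagε_π).trans G.ε_s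
  ε_t := (congrArg (fun f => f.comp G.t) G.diagε_π).trans G.ε_t
  one_conv := G.diag_ext <| by
    have h := congrArg (fun f => G.π.comp f) G.one_conv
    have c : (G.π.comp (G.t.comp G.ε)).comp G.s = (G.π.comp (RingHom.id A)).comp G.t := by
      simp only [RingHom.comp_assoc, G.ε_s]; rfl
    have e : ((G.π.comp G.t).comp G.diagε).comp G.π = G.π.comp (G.t.comp G.ε) := by
      rw [RingHom.comp_assoc, diagε_π]; rfl
    refine (G.diag_conv_π _ _ _ ?_).trans ((G.conv_congr e rfl ?_ c).trans
      ((G.comp_conv _ _ _ _ _).symm.trans h))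
    · exact (congrArg (fun f => f.comp G.s) e).trans c
    · exact (congrArg (fun f => f.comp G.s) e).trans c
  conv_one := G.diag_ext <| by
    have h := congrArg (fun f => G.π.comp f) G.conv_one
    have c : (G.π.comp (RingHom.id A)).comp G.s = (G.π.comp (G.s.comp G.ε)).comp G.t := by
      simp only [RingHom.comp_assoc, G.ε_t]; rfl
    have e : ((G.π.comp G.s).comp G.diagε).comp G.π = G.π.comp (G.s.comp G.ε) := by
      rw [RingHom.comp_assoc, diagε_π]; rfl
    refine (G.diag_conv_π _ _ _ ?_).trans ((G.conv_congr rfl e ?_ c).trans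
      ((G.comp_conv _ _ _ _ _).symm.trans h))
    · exact c.trans (congrArg (fun f => f.comp G.t) e).symm
    · exact c.trans (congrArg (fun f => f.comp G.t) e).symm
  ι := G.diagι
  ι_s := (congrArg (fun f => f.comp G.s) G.diagι_π).trans
    ((RingHom.comp_assoc _ _ _).trans (congrArg (fun f => G.π.comp f) G.ι_s))
  ι_t := (congrArg (fun f => f.comp G.t) G.diagι_π).trans
    ((RingHom.comp_assoc _ _ _).trans (congrArg (fun f => G.π.comp f) G.ι_t))
  inv_conv := G.diag_ext <| by
    have h := congrArg (fun f => G.π.comp f) G.inv_conv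
    have c : (G.π.comp G.ι).comp G.s = (G.π.comp (RingHom.id A)).comp G.t := by
      rw [RingHom.comp_assoc, G.ι_s]; rfl
    refine (G.diag_conv_π _ _ _ ?_).trans ((G.conv_congr G.diagι_π rfl ?_ c).trans
      ((G.comp_conv _ _ _ _ _).symm.trans (h.trans ?_)))
    · rw [diagι_π]; exact c
    · rw [diagι_π]; exact c
    · change G.π.comp (G.s.comp G.ε) = (G.π.comp G.s).comp (G.diagε.comp G.π)
      rw [diagε_π]; rfl
  conv_inv := G.diag_ext <| by
    have h := congrArg (fun f => G.π.comp f) G.conv_inv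
    have c : (G.π.comp (RingHom.id A)).comp G.s = (G.π.comp G.ι).comp G.t := by
      rw [RingHom.comp_assoc (g := G.ι), G.ι_t]; rfl
    refine (G.diag_conv_π _ _ _ ?_).trans ((G.conv_congr rfl G.diagι_π ?_ c).trans
      ((G.comp_conv _ _ _ _ _).symm.trans (h.trans ?_)))
    · rw [diagι_π]; exact c
    · rw [diagι_π]; exact c
    · change G.π.comp (G.t.comp G.ε) = (G.π.comp G.t).comp (G.diagε.comp G.π)
      rw [diagε_π]; rfl

theorem diag_s : G.diag.s = G.π.comp G.s := rfl

theorem diag_t : G.diag.t = G.π.comp G.t := rfl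

theorem diag_s_eq_t : G.diag.s = G.diag.t := G.π_s

end Basic

end AffineGroupoid

namespace Along

variable {R C C' C'' : Type u} [CommRing R] [CommRing C] [CommRing C'] [CommRing C'']
  (V : Type u) [AddCommGroup V] [Module R V]

/-- Base change `C ⊗_R V → C' ⊗_R V` along a map of `R`-algebras `x : C → C'`. -/
def pull (x : C →+* C') {b : R →+* C} {b' : R →+* C'} (h : x.comp b = b') :
    Along b ⊗[R] V →ₗ[R] Along b' ⊗[R] V :=
  LinearMap.rTensor V (Along.map x h).toLinearMap

variable {V}

theorem pull_tmul (x : C →+* C') {b : R →+* C} {b' : R →+* C'} (h : x.comp b = b') (c : C)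
    (v : V) : pull V x h (of b c ⊗ₜ v) = of b' (x c) ⊗ₜ v := rfl

theorem smul_tmul_of {b : R →+* C} (d c : C) (v : V) :
    d • (of b c ⊗ₜ[R] v) = of b (d * c) ⊗ₜ v := rfl

theorem tmul_smul_of {b : R →+* C} (c : C) (r : R) (v : V) :
    of b c ⊗ₜ[R] (r • v) = of b (b r * c) ⊗ₜ v := (TensorProduct.smul_tmul r (of b c) v).symm

theorem smul_eq {b : R →+* C} (r : R) (ξ : Along b ⊗[R] V) : r • ξ = b r • ξ := by
  induction ξ using TensorProduct.induction_on with
  | zero => rw [smul_zero, smul_zero]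
  | add x y hx hy => rw [smul_add, smul_add, hx, hy]
  | tmul c v => rfl

theorem induct {b : R →+* C} {motive : Along b ⊗[R] V → Prop} (ξ : Along b ⊗[R] V)
    (zero : motive 0) (tmul : ∀ (c : C) (v : V), motive (of b c ⊗ₜ v))
    (add : ∀ x y, motive x → motive y → motive (x + y)) : motive ξ :=
  TensorProduct.induction_on ξ zero tmul add

theorem pull_smul (x : C →+* C') {b : R →+* C} {b' : R →+* C'} (h : x.comp b = b') (c : C)
    (ξ : Along b ⊗[R] V) : pull V x h (c • ξ) = x c • pull V x h ξ := by
  induction ξ using induct with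
  | zero => simp
  | add y z hy hz => rw [smul_add, map_add, map_add, smul_add, hy, hz]
  | tmul d v => rw [smul_tmul_of, pull_tmul, pull_tmul, smul_tmul_of, map_mul]

theorem pull_pull (y : C' →+* C'') (x : C →+* C') {b : R →+* C} {b' : R →+* C'}
    {b'' : R →+* C''} (h : x.comp b = b') (h' : y.comp b' = b'') (h'' : (y.comp x).comp b = b'')
    (ξ : Along b ⊗[R] V) : pull V y h' (pull V x h ξ) = pull V (y.comp x) h'' ξ := by
  induction ξ using induct with
  | zero => simp
  | add y z hy hz => rw [map_add, map_add, map_add, hy, hz]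
  | tmul d v => rfl

theorem pull_congr {x y : C →+* C'} (e : x = y) {b : R →+* C} {b' : R →+* C'}
    (h : x.comp b = b') (h' : y.comp b = b') (ξ : Along b ⊗[R] V) :
    pull V x h ξ = pull V y h' ξ := by subst e; rfl

theorem pull_id {b : R →+* C} (h : (RingHom.id C).comp b = b) (ξ : Along b ⊗[R] V) :
    pull V (RingHom.id C) h ξ = ξ := by
  induction ξ using induct with
  | zero => simp
  | add y z hy hz => rw [map_add, hy, hz]
  | tmul d v => rfl

theorem lTensor_smul {b : R →+* C} {V' : Type u} [AddCommGroup V'] [Module R V']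
    (f : V →ₗ[R] V') (c : C) (ξ : Along b ⊗[R] V) :
    LinearMap.lTensor (Along b) f (c • ξ) = c • LinearMap.lTensor (Along b) f ξ := by
  induction ξ using induct with
  | zero => simp
  | add y z hy hz => rw [smul_add, map_add, map_add, smul_add, hy, hz]
  | tmul d v => rfl

theorem lTensor_pull {V' : Type u} [AddCommGroup V'] [Module R V'] (f : V →ₗ[R] V')
    (x : C →+* C') {b : R →+* C} {b' : R →+* C'} (h : x.comp b = b') (ξ : Along b ⊗[R] V) :
    LinearMap.lTensor (Along b') f (pull V x h ξ) =
      pull V' x h (LinearMap.lTensor (Along b) f ξ) := by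
  induction ξ using induct with
  | zero => simp
  | add y z hy hz => simp only [map_add, hy, hz]
  | tmul d v => rfl

/-- For a retraction `e` of `b`, the map `C ⊗_R V → V`, `c ⊗ v ↦ e(c) v`. -/
def ev {b : R →+* C} (e : C →+* R) (h : e.comp b = RingHom.id R) (V : Type u) [AddCommGroup V]
    [Module R V] : Along b ⊗[R] V →+ V :=
  TensorProduct.liftAddHom
    (AddMonoidHom.mk' (fun c => AddMonoidHom.mk' (fun v => e (out b c) • v)
      (fun v w => smul_add _ v w)) (fun c d => by
        ext v
        change e (out b (c + d)) • v = e (out b c) • v + e (out b d) • v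
        rw [map_add, map_add, add_smul]))
    (fun r c v => by
      change e (b r * out b c) • v = e (out b c) • r • v
      have : e (b r) = r := RingHom.congr_fun h r
      rw [map_mul, this, smul_smul, mul_comm])

theorem ev_tmul {b : R →+* C} (e : C →+* R) (h : e.comp b = RingHom.id R) (c : C) (v : V) :
    ev e h V (of b c ⊗ₜ v) = e c • v := rfl

theorem ev_smul {b : R →+* C} (e : C →+* R) (h : e.comp b = RingHom.id R) (c : C)
    (ξ : Along b ⊗[R] V) : ev e h V (c • ξ) = e c • ev e h V ξ := by
  induction ξ using induct with
  | zero => simp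
  | add y z hy hz => rw [smul_add, map_add, map_add, smul_add, hy, hz]
  | tmul d v => rw [smul_tmul_of, ev_tmul, ev_tmul, map_mul, mul_smul]

theorem ev_lTensor {V' : Type u} [AddCommGroup V'] [Module R V'] (f : V →ₗ[R] V')
    {b : R →+* C} (e : C →+* R) (h : e.comp b = RingHom.id R) (ξ : Along b ⊗[R] V) :
    ev e h V' (LinearMap.lTensor (Along b) f ξ) = f (ev e h V ξ) := by
  induction ξ using induct with
  | zero => simp
  | add y z hy hz => simp only [map_add, hy, hz]
  | tmul d v => rw [LinearMap.lTensor_tmul, ev_tmul, ev_tmul, map_smul]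

theorem pull_ev {b : R →+* C} (e : C →+* R) (h : e.comp b = RingHom.id R) {b' : R →+* C'}
    (h' : (b'.comp e).comp b = b') (ξ : Along b ⊗[R] V) :
    pull V (b'.comp e) h' ξ = of b' 1 ⊗ₜ ev e h V ξ := by
  induction ξ using induct with
  | zero => simp
  | add y z hy hz => simp only [map_add, TensorProduct.tmul_add, hy, hz]
  | tmul d v => rw [pull_tmul, ev_tmul, tmul_smul_of, mul_one]; rfl

end Along

namespace PreGroupoid

open Along

variable {k R A C C' : Type u} [CommRing k] [CommRing R] [CommRing A] [Algebra k R]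
  [Algebra k A] [CommRing C] [CommRing C'] (G : PreGroupoid k R A)
  {V : Type u} [AddCommGroup V] [Module R V]

/-- The action of a `C`-valued point `x` of source `a` and target `b`, through a coaction `ρ`:
the `C`-linear map `a^* V → b^* V` with `c ⊗ v ↦ c x(ρ(v))`. -/
def act (ρ : V →+ Along G.t ⊗[R] V) (hρ : ∀ (r : R) (v : V), ρ (r • v) = G.s r • ρ v)
    (x : A →+* C) {a b : R →+* C} (ha : x.comp G.s = a) (hb : x.comp G.t = b) :
    Along a ⊗[R] V →+ Along b ⊗[R] V :=
  TensorProduct.liftAddHom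
    (AddMonoidHom.mk' (fun c => AddMonoidHom.mk' (fun v => out a c • pull V x hb (ρ v))
      (fun v w => by rw [map_add, map_add, smul_add])) (fun c d => by
        ext v
        change out a (c + d) • pull V x hb (ρ v) = _
        rw [map_add, add_smul]; rfl))
    (fun r c v => by
      change (a r * out a c) • pull V x hb (ρ v) = out a c • pull V x hb (ρ (r • v))
      have : x (G.s r) = a r := RingHom.congr_fun ha r
      rw [hρ, pull_smul, this, smul_smul, mul_comm])

variable (ρ : V →+ Along G.t ⊗[R] V) (hρ : ∀ (r : R) (v : V), ρ (r • v) = G.s r • ρ v)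
  (x : A →+* C) {a b : R →+* C} (ha : x.comp G.s = a) (hb : x.comp G.t = b)

theorem act_tmul (c : C) (v : V) :
    G.act ρ hρ x ha hb (of a c ⊗ₜ v) = c • pull V x hb (ρ v) := rfl

theorem act_smul (c : C) (ξ : Along a ⊗[R] V) :
    G.act ρ hρ x ha hb (c • ξ) = c • G.act ρ hρ x ha hb ξ := by
  induction ξ using induct with
  | zero => simp
  | add y z hy hz => rw [smul_add, map_add, map_add, smul_add, hy, hz]
  | tmul d v => rw [smul_tmul_of, act_tmul, act_tmul, mul_smul]

theorem act_congr {x y : A →+* C} (e : x = y) (ha : x.comp G.s = a) (hb : x.comp G.t = b)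
    (ha' : y.comp G.s = a) (hb' : y.comp G.t = b) (ξ : Along a ⊗[R] V) :
    G.act ρ hρ x ha hb ξ = G.act ρ hρ y ha' hb' ξ := by subst e; rfl

theorem pull_act (f : C →+* C') {a' b' : R →+* C'} (hfa : f.comp a = a') (hfb : f.comp b = b')
    (ha' : (f.comp x).comp G.s = a') (hb' : (f.comp x).comp G.t = b') (ξ : Along a ⊗[R] V) :
    pull V f hfb (G.act ρ hρ x ha hb ξ) = G.act ρ hρ (f.comp x) ha' hb' (pull V f hfa ξ) := by
  induction ξ using induct with
  | zero => simp
  | add y z hy hz => simp only [map_add, hy, hz]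
  | tmul d v => rw [act_tmul, pull_smul, pull_tmul, act_tmul, pull_pull]

theorem lTensor_act {V' : Type u} [AddCommGroup V'] [Module R V'] (f : V →ₗ[R] V')
    (ρ' : V' →+ Along G.t ⊗[R] V') (hρ' : ∀ (r : R) (v : V'), ρ' (r • v) = G.s r • ρ' v)
    (hf : ∀ v, LinearMap.lTensor (Along G.t) f (ρ v) = ρ' (f v)) (ξ : Along a ⊗[R] V) :
    LinearMap.lTensor (Along b) f (G.act ρ hρ x ha hb ξ) =
      G.act ρ' hρ' x ha hb (LinearMap.lTensor (Along a) f ξ) := by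
  induction ξ using induct with
  | zero => simp
  | add y z hy hz => simp only [map_add, hy, hz]
  | tmul d v => rw [act_tmul, lTensor_smul, LinearMap.lTensor_tmul, act_tmul, lTensor_pull, hf]

end PreGroupoid

/-- A representation of `G`: an `R`-module `V` with a coaction `ρ : V → A ⊗_R V`, where `A` is an
`R`-module through `t`, which is linear for the `R`-module structure of the target through `s`,
and is counital and coassociative, `(id ⊗ Δ) ρ = (ρ ⊗ id) ρ` in `A ⊗_R A ⊗_R V`. -/
structure GModule {k R A : Type u} [CommRing k] [CommRing R] [CommRing A] [Algebra k R]
    [Algebra k A] (G : AffineGroupoid k R A) where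
  V : Type u
  [addCommGroup : AddCommGroup V]
  [module : Module R V]
  ρ : V →+ Along G.t ⊗[R] V
  ρ_smul : ∀ (r : R) (v : V), ρ (r • v) = G.s r • ρ v
  counit : ∀ v, Along.ev G.ε G.ε_t V (ρ v) = v
  coassoc : ∀ v,
    G.act ρ ρ_smul (Fib.inl G.s G.t) rfl rfl
        (Along.pull V (Fib.inr G.s G.t) (Fib.inl_comp G.s G.t).symm (ρ v)) =
      Along.pull V G.Δ G.Δ_t (ρ v)

namespace GModule

attribute [instance] GModule.addCommGroup GModule.module

section Category

variable {k R A : Type u} [CommRing k] [CommRing R] [CommRing A] [Algebra k R]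
  [Algebra k A] {G : AffineGroupoid k R A}

/-- A morphism of representations: an `R`-linear map compatible with the coactions. -/
@[ext]
structure Hom (X Y : GModule G) where
  f : X.V →ₗ[R] Y.V
  comm : ∀ v, LinearMap.lTensor (Along G.t) f (X.ρ v) = Y.ρ (f v)

instance : Category (GModule G) where
  Hom := Hom
  id X := ⟨LinearMap.id, fun v => by rw [LinearMap.lTensor_id]; rfl⟩
  comp φ ψ := ⟨ψ.f ∘ₗ φ.f, fun v => by
    rw [LinearMap.lTensor_comp, LinearMap.comp_apply, φ.comm, ψ.comm]; rfl⟩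

theorem id_f (X : GModule G) : Hom.f (𝟙 X) = LinearMap.id := rfl

theorem comp_f {X Y Z : GModule G} (φ : X ⟶ Y) (ψ : Y ⟶ Z) :
    Hom.f (φ ≫ ψ) = Hom.f ψ ∘ₗ Hom.f φ := rfl

theorem hom_ext {X Y : GModule G} {φ ψ : X ⟶ Y} (h : Hom.f φ = Hom.f ψ) : φ = ψ := Hom.ext h

/-- Exactness of a sequence `X → Y → Z` of representations at `Y`: the image of `X` is the kernel
of `Y → Z`. For flat `G`, kernels and images of representations are those of `R`-modules. -/
def IsExact {X Y Z : GModule G} (φ : X ⟶ Y) (ψ : Y ⟶ Z) : Prop :=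
  Function.Exact (Hom.f φ) (Hom.f ψ)

end Category

end GModule

/-- The module `P ⊗_R W` (with `P` an `R`-module through `e : R → P`), regarded as an `R`-module
through the multiplication of `P` and another ring map `q : R → P`. -/
def Twist {R P : Type u} [CommRing R] [CommRing P] (e _q : R →+* P) (W : Type u) [AddCommGroup W]
    [Module R W] : Type u := Along e ⊗[R] W

namespace Twist

open Along

variable {R P Q Q' : Type u} [CommRing R] [CommRing P] [CommRing Q] [CommRing Q'] {e q : R →+* P}
  {W : Type u} [AddCommGroup W] [Module R W]

instance : AddCommGroup (Twist e q W) := inferInstanceAs (AddCommGroup (Along e ⊗[R] W))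

instance : Module R (Twist e q W) := Module.compHom (Along e ⊗[R] W) q

/-- The identity map. -/
def mk (e q : R →+* P) (W : Type u) [AddCommGroup W] [Module R W] :
    Along e ⊗[R] W →+ Twist e q W := AddMonoidHom.id _

/-- The identity map, backwards. -/
def out (e q : R →+* P) (W : Type u) [AddCommGroup W] [Module R W] :
    Twist e q W →+ Along e ⊗[R] W := AddMonoidHom.id _

theorem out_smul (r : R) (ξ : Twist e q W) : out e q W (r • ξ) = q r • out e q W ξ := rfl

theorem smul_mk (r : R) (ξ : Along e ⊗[R] W) : r • mk e q W ξ = mk e q W (q r • ξ) := rfl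

theorem out_mk (ξ : Along e ⊗[R] W) : out e q W (mk e q W ξ) = ξ := rfl

theorem mk_out (ξ : Twist e q W) : mk e q W (out e q W ξ) = ξ := rfl

/-- For fixed `w`, the `R`-linear map `p ↦ p ⊗ w`. -/
def left (e q : R →+* P) (w : W) : Along q →ₗ[R] Twist e q W where
  toFun p := mk e q W (of e (Along.out q p) ⊗ₜ w)
  map_add' p p' := by rw [map_add, map_add, TensorProduct.add_tmul, map_add]
  map_smul' _ _ := rfl

/-- The canonical map `(P ⊗_R Q) ⊗_R W → Q ⊗_R (P ⊗_R W)`, `(p ⊗ d) ⊗ w ↦ d ⊗ (p ⊗ w)`. -/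
def reassoc (e q : R →+* P) (τ : R →+* Q) (W : Type u) [AddCommGroup W] [Module R W] :
    Along ((Fib.inl q τ).comp e) ⊗[R] W →+ Along τ ⊗[R] Twist e q W :=
  TensorProduct.liftAddHom
    (AddMonoidHom.flip (AddMonoidHom.mk' (fun w =>
      (((TensorProduct.comm R (Twist e q W) (Along τ)).toLinearMap ∘ₗ
        LinearMap.rTensor (Along τ) (left e q w)).toAddMonoidHom :
          Fib q τ →+ Along τ ⊗[R] Twist e q W)) (fun w w' => by
        have : left e q (w + w') = left e q w + left e q w' := by
          ext p
          change mk e q W (of e (Along.out q p) ⊗ₜ (w + w')) = _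
          rw [TensorProduct.tmul_add, map_add]; rfl
        rw [this, LinearMap.rTensor_add, LinearMap.comp_add]; rfl)))
    (fun r z w => by
      change TensorProduct.comm R _ _ (LinearMap.rTensor (Along τ) (left e q w)
          (Fib.inl q τ (e r) * Along.out _ z)) =
        TensorProduct.comm R _ _ (LinearMap.rTensor (Along τ) (left e q (r • w)) (Along.out _ z))
      congr 1
      generalize (Along.out _ z : Fib q τ) = y
      induction y using TensorProduct.induction_on with
      | zero => simp
      | add y y' h h' => rw [mul_add, map_add, map_add, h, h']
      | tmul p d =>
        rw [Fib.inl_apply, Algebra.TensorProduct.tmul_mul_tmul, one_mul,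
          LinearMap.rTensor_tmul, LinearMap.rTensor_tmul]
        congr 1
        exact congrArg (mk e q W) (tmul_smul_of (b := e) (Along.out q p) r w).symm)

theorem reassoc_tmul (τ : R →+* Q) (p : P) (d : Q) (w : W) :
    reassoc e q τ W (of _ (Fib.inl q τ p * Fib.inr q τ d) ⊗ₜ w) =
      of τ d ⊗ₜ mk e q W (of e p ⊗ₜ w) := by
  rw [← Fib.tmul_eq]; rfl

theorem induct_fib {τ : R →+* Q}
    {motive : Along ((Fib.inl q τ).comp e) ⊗[R] W → Prop}
    (η : Along ((Fib.inl q τ).comp e) ⊗[R] W) (zero : motive 0)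
    (tmul : ∀ (p : P) (d : Q) (w : W), motive (of _ (Fib.inl q τ p * Fib.inr q τ d) ⊗ₜ w))
    (add : ∀ x y, motive x → motive y → motive (x + y)) : motive η := by
  induction η using induct with
  | zero => exact zero
  | add x y hx hy => exact add x y hx hy
  | tmul z w =>
    induction z using TensorProduct.induction_on with
    | zero => rw [map_zero, TensorProduct.zero_tmul]; exact zero
    | add x y hx hy => rw [map_add, TensorProduct.add_tmul]; exact add _ _ hx hy
    | tmul p d =>
      have := tmul (Along.out q p) (Along.out τ d) w
      rw [← Fib.tmul_eq] at this
      exact this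

theorem reassoc_smul (τ : R →+* Q) (d : Q) (η : Along ((Fib.inl q τ).comp e) ⊗[R] W) :
    reassoc e q τ W (Fib.inr q τ d • η) = d • reassoc e q τ W η := by
  induction η using induct_fib with
  | zero => simp
  | add x y hx hy => rw [smul_add, map_add, map_add, smul_add, hx, hy]
  | tmul p d' w =>
    rw [smul_tmul_of, mul_left_comm, ← map_mul, reassoc_tmul, reassoc_tmul, smul_tmul_of]

theorem reassoc_inl (τ : R →+* Q) (p : P) (d : Q) (ζ : Along e ⊗[R] W) :
    reassoc e q τ W ((Fib.inl q τ p * Fib.inr q τ d) • pull W (Fib.inl q τ) rfl ζ) =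
      of τ d ⊗ₜ mk e q W (p • ζ) := by
  induction ζ using induct with
  | zero => simp
  | add x y hx hy => simp only [map_add, smul_add, TensorProduct.tmul_add, hx, hy]
  | tmul p' w =>
    rw [pull_tmul, smul_tmul_of, smul_tmul_of, mul_right_comm, ← map_mul, reassoc_tmul]

/-- Base change of `P ⊗_R Q` along a map of `R`-algebras `x : Q → Q'`. -/
def fibMap (q : R →+* P) (x : Q →+* Q') {τ : R →+* Q} {τ' : R →+* Q'} (h : x.comp τ = τ') :
    Fib q τ →+* Fib q τ' :=
  Fib.lift (Fib.inl q τ') ((Fib.inr q τ').comp x)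
    (by rw [RingHom.comp_assoc, h]; exact Fib.inl_comp q τ')

theorem fibMap_inl (x : Q →+* Q') {τ : R →+* Q} {τ' : R →+* Q'} (h : x.comp τ = τ') :
    (fibMap q x h).comp (Fib.inl q τ) = Fib.inl q τ' := Fib.lift_inl _ _ _

theorem fibMap_inr (x : Q →+* Q') {τ : R →+* Q} {τ' : R →+* Q'} (h : x.comp τ = τ') :
    (fibMap q x h).comp (Fib.inr q τ) = (Fib.inr q τ').comp x := Fib.lift_inr _ _ _

theorem pull_reassoc (x : Q →+* Q') {τ : R →+* Q} {τ' : R →+* Q'} (h : x.comp τ = τ')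
    (h' : (fibMap q x h).comp ((Fib.inl q τ).comp e) = (Fib.inl q τ').comp e)
    (η : Along ((Fib.inl q τ).comp e) ⊗[R] W) :
    pull (Twist e q W) x h (reassoc e q τ W η) =
      reassoc e q τ' W (pull W (fibMap q x h) h' η) := by
  induction η using induct_fib with
  | zero => simp
  | add x y hx hy => simp only [map_add, hx, hy]
  | tmul p d w =>
    have e1 := RingHom.congr_fun (fibMap_inl (q := q) x h) p
    have e2 := RingHom.congr_fun (fibMap_inr (q := q) x h) d
    simp only [RingHom.comp_apply] at e1 e2
    rw [reassoc_tmul, pull_tmul, pull_tmul, map_mul, e1, e2, reassoc_tmul]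

/-- Functoriality in `W`. -/
def lmap (e q : R →+* P) {W' : Type u} [AddCommGroup W'] [Module R W'] (f : W →ₗ[R] W') :
    Twist e q W →ₗ[R] Twist e q W' where
  toFun ξ := mk e q W' (LinearMap.lTensor (Along e) f (out e q W ξ))
  map_add' ξ η := by simp only [map_add]
  map_smul' r ξ := by rw [out_smul, lTensor_smul, ← smul_mk]; rfl

theorem reassoc_lmap (τ : R →+* Q) {W' : Type u} [AddCommGroup W'] [Module R W'] (f : W →ₗ[R] W')
    (η : Along ((Fib.inl q τ).comp e) ⊗[R] W) :
    LinearMap.lTensor (Along τ) (lmap e q f) (reassoc e q τ W η) =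
      reassoc e q τ W' (LinearMap.lTensor _ f η) := by
  induction η using induct_fib with
  | zero => simp
  | add x y hx hy => simp only [map_add, hx, hy]
  | tmul p d w =>
    rw [LinearMap.lTensor_tmul, reassoc_tmul, reassoc_tmul, LinearMap.lTensor_tmul]; rfl

end Twist

namespace GModule

open Along Twist

variable {k R A : Type u} [CommRing k] [CommRing R] [CommRing A] [Algebra k R]
  [Algebra k A] {G : AffineGroupoid k R A}

theorem act_pull (X : GModule G) {C : Type u} [CommRing C] (x y : A →+* C)
    (h : x.comp G.s = y.comp G.t) {a b : R →+* C} (ha : x.comp G.s = a) (hb : x.comp G.t = b)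
    (hy : y.comp G.t = a) (hc : (G.conv x y h).comp G.t = b) (v : X.V) :
    G.act X.ρ X.ρ_smul x ha hb (pull X.V y hy (X.ρ v)) = pull X.V (G.conv x y h) hc (X.ρ v) := by
  have key := congrArg (pull X.V (Fib.lift x y h) (b' := b)
    (by rw [← RingHom.comp_assoc, Fib.lift_inl, hb])) (X.coassoc v)
  rw [pull_pull _ _ _ _ (hc)] at key
  refine Eq.trans ?_ key
  have e1 : (Fib.lift x y h).comp ((Fib.inl G.s G.t).comp G.s) = a := by
    rw [← RingHom.comp_assoc, Fib.lift_inl, ha]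
  rw [G.pull_act (hfa := e1) (ha' := e1) (hb' := by rw [Fib.lift_inl, hb]),
    pull_pull _ _ _ _ (by rw [Fib.lift_inr, hy])]
  rw [pull_congr (Fib.lift_inr x y h)]
  exact G.act_congr _ _ (Fib.lift_inl x y h).symm _ _ _ _ _

/-- The coaction of `O(G^Δ)` induced by a coaction of `O(G)`. -/
def resρ (X : GModule G) : X.V →+ Along G.diag.t ⊗[R] X.V :=
  (pull X.V G.π (b' := G.diag.t) G.diag_t.symm).toAddMonoidHom.comp X.ρ

theorem resρ_apply (X : GModule G) (v : X.V) :
    X.resρ v = pull X.V G.π (b' := G.diag.t) G.diag_t.symm (X.ρ v) := rfl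

theorem resρ_smul (X : GModule G) (r : R) (v : X.V) : X.resρ (r • v) = G.diag.s r • X.resρ v := by
  rw [resρ_apply, X.ρ_smul, pull_smul]; rfl

theorem res_act (X : GModule G) {C : Type u} [CommRing C] (x : G.DiagRing →+* C)
    {a b : R →+* C} (ha : x.comp G.diag.s = a) (hb : x.comp G.diag.t = b)
    (ha' : (x.comp G.π).comp G.s = a) (hb' : (x.comp G.π).comp G.t = b) (ξ : Along a ⊗[R] X.V) :
    G.diag.act X.resρ X.resρ_smul x ha hb ξ = G.act X.ρ X.ρ_smul (x.comp G.π) ha' hb' ξ := by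
  induction ξ using induct with
  | zero => simp
  | add x y hx hy => simp only [map_add, hx, hy]
  | tmul c v => rw [PreGroupoid.act_tmul, PreGroupoid.act_tmul, resρ_apply, pull_pull]

/-- The restriction of a representation of `G` to the diagonal group scheme. -/
def res (X : GModule G) : GModule G.diag where
  V := X.V
  ρ := X.resρ
  ρ_smul := X.resρ_smul
  counit v := by
    refine Eq.trans ?_ (X.counit v)
    rw [resρ_apply]
    generalize X.ρ v = ξ
    induction ξ using induct with
    | zero => simp
    | add x y hx hy => simp only [map_add, hx, hy]
    | tmul c v => rfl
  coassoc v := by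
    have c := Fib.inl_comp G.diag.s G.diag.t
    have hΔ : G.diag.Δ.comp G.π = G.conv ((Fib.inl G.diag.s G.diag.t).comp G.π)
      ((Fib.inr G.diag.s G.diag.t).comp G.π) c := G.diagΔ_π
    refine (X.res_act (Fib.inl G.diag.s G.diag.t) rfl rfl rfl rfl _).trans ?_
    have c' : ((Fib.inr G.diag.s G.diag.t).comp G.π).comp G.t =
      (Fib.inl G.diag.s G.diag.t).comp G.diag.s := c.symm
    have d : (G.conv ((Fib.inl G.diag.s G.diag.t).comp G.π)
      ((Fib.inr G.diag.s G.diag.t).comp G.π) c).comp G.t = (Fib.inl G.diag.s G.diag.t).comp G.diag.t :=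
      G.conv_t ((Fib.inl G.diag.s G.diag.t).comp G.π) ((Fib.inr G.diag.s G.diag.t).comp G.π) c
    have d' : (G.diag.Δ.comp G.π).comp G.t = (Fib.inl G.diag.s G.diag.t).comp G.diag.t := by
      rw [hΔ, d]
    refine Eq.trans (congrArg _ (pull_pull _ _ _ _ c' _)) ((X.act_pull _ _ c rfl rfl c' d v).trans ?_)
    exact ((pull_pull _ _ _ _ d' _).trans (pull_congr hΔ d' d _)).symm

/-- The coaction `id ⊗ Δ` on `W ⊗_R A` for an `R`-module `W`: the trivial action on `W` and the
regular one on `A`. -/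
def regular (G : AffineGroupoid k R A) (W : Type u) [AddCommGroup W] [Module R W] :
    Twist G.t G.s W →+ Along G.t ⊗[R] Twist G.t G.s W :=
  (reassoc G.t G.s G.t W).comp ((pull W G.Δ G.Δ_t).toAddMonoidHom.comp (Twist.out G.t G.s W))

section Cofree

variable (W : Type u) [AddCommGroup W] [Module R W]

theorem regular_apply (ξ : Twist G.t G.s W) :
    regular G W ξ = reassoc G.t G.s G.t W (pull W G.Δ G.Δ_t (Twist.out G.t G.s W ξ)) := rfl

theorem regular_smul (r : R) (ξ : Twist G.t G.s W) :
    regular G W (r • ξ) = G.s r • regular G W ξ := by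
  have : G.Δ (G.s r) = Fib.inr G.s G.t (G.s r) := RingHom.congr_fun G.Δ_s r
  rw [regular_apply, out_smul, pull_smul, this, reassoc_smul]; rfl

theorem conv_inl_t {C : Type u} [CommRing C] (x : A →+* C) {b : R →+* C} (hb : x.comp G.t = b) :
    (Fib.inl G.s b).comp G.s = ((Fib.inr G.s b).comp x).comp G.t := by
  rw [RingHom.comp_assoc, hb, Fib.inl_comp]

/-- The universal point composed with `x`. -/
def rmul (G : AffineGroupoid k R A) {C : Type u} [CommRing C] (x : A →+* C) {b : R →+* C}
    (hb : x.comp G.t = b) : A →+* Fib G.s b :=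
  G.conv (Fib.inl G.s b) ((Fib.inr G.s b).comp x) (conv_inl_t x hb)

theorem rmul_t {C : Type u} [CommRing C] (x : A →+* C) {b : R →+* C}
    (hb : x.comp G.t = b) : (rmul G x hb).comp G.t = (Fib.inl G.s b).comp G.t := G.conv_t _ _ _

theorem rmul_s {C : Type u} [CommRing C] (x : A →+* C) {a b : R →+* C}
    (ha : x.comp G.s = a) (hb : x.comp G.t = b) :
    (rmul G x hb).comp G.s = (Fib.inr G.s b).comp a := by
  rw [rmul, G.conv_s, RingHom.comp_assoc, ha]

theorem lift_rmul {C : Type u} [CommRing C] (x y : A →+* C) {a b : R →+* C}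
    (ha : x.comp G.s = a) (hb : x.comp G.t = b) (hy : y.comp G.t = a)
    (hc : (G.conv x y (ha.trans hy.symm)).comp G.t = b) :
    (Fib.lift (rmul G x hb) (Fib.inr G.s b) (rmul_s x ha hb)).comp (rmul G y hy) =
      rmul G (G.conv x y (ha.trans hy.symm)) hc := by
  have e1 := Fib.lift_inl _ _ (rmul_s x ha hb)
  have e2 : (Fib.lift _ _ (rmul_s x ha hb)).comp ((Fib.inr G.s a).comp y) =
      (Fib.inr G.s b).comp y := by rw [← RingHom.comp_assoc, Fib.lift_inr]
  have c : (rmul G x hb).comp G.s = ((Fib.inr G.s b).comp y).comp G.t := by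
    rw [rmul_s x ha hb, RingHom.comp_assoc, hy]
  have c' : ((Fib.inr G.s b).comp x).comp G.s = ((Fib.inr G.s b).comp y).comp G.t := by
    rw [RingHom.comp_assoc, ha, RingHom.comp_assoc, hy]
  rw [rmul.eq_def (x := y), G.comp_conv (h' := by rw [e1, e2]; exact c), G.conv_congr e1 e2 (h' := c)]
  refine (G.conv_assoc _ _ _ (conv_inl_t x hb) c').trans ?_
  exact G.conv_congr rfl (G.comp_conv _ _ _ _ _).symm _ _

theorem conv_inl_inr : G.conv (Fib.inl G.s G.t) (Fib.inr G.s G.t) (Fib.inl_comp _ _) = G.Δ := by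
  have : Fib.lift (Fib.inl G.s G.t) (Fib.inr G.s G.t) (Fib.inl_comp _ _) = RingHom.id _ :=
    Fib.hom_ext (Fib.lift_inl _ _ _) (Fib.lift_inr _ _ _)
  rw [PreGroupoid.conv, this]; rfl

theorem pull_regular {C : Type u} [CommRing C] (x : A →+* C) {b : R →+* C}
    (hb : x.comp G.t = b) (ξ : Twist G.t G.s W) :
    pull _ x hb (regular G W ξ) =
      reassoc G.t G.s b W (pull W (rmul G x hb) (rmul_t x hb) (Twist.out G.t G.s W ξ)) := by
  rw [regular_apply, pull_reassoc (h' := by rw [← RingHom.comp_assoc, fibMap_inl]),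
    pull_pull _ _ _ _ (by
      rw [RingHom.comp_assoc, G.Δ_t, ← RingHom.comp_assoc, fibMap_inl])]
  rfl

theorem act_regular {C : Type u} [CommRing C] (x : A →+* C) {a b : R →+* C}
    (ha : x.comp G.s = a) (hb : x.comp G.t = b)
    (h' : (Fib.lift (rmul G x hb) (Fib.inr G.s b) (rmul_s x ha hb)).comp ((Fib.inl G.s a).comp G.t) =
      (Fib.inl G.s b).comp G.t)
    (η : Along ((Fib.inl G.s a).comp G.t) ⊗[R] W) :
    G.act (regular G W) (regular_smul W) x ha hb (reassoc G.t G.s a W η) =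
      reassoc G.t G.s b W (pull W (Fib.lift (rmul G x hb) (Fib.inr G.s b) (rmul_s x ha hb)) h' η) := by
  induction η using induct_fib with
  | zero => simp
  | add x y hx hy => simp only [map_add, hx, hy]
  | tmul p d w =>
    have e1 := RingHom.congr_fun (Fib.lift_inl (rmul G x hb) (Fib.inr G.s b) (rmul_s x ha hb)) p
    have e2 := RingHom.congr_fun (Fib.lift_inr (rmul G x hb) (Fib.inr G.s b) (rmul_s x ha hb)) d
    simp only [RingHom.comp_apply] at e1 e2
    rw [reassoc_tmul, G.act_tmul, pull_regular, pull_tmul, map_mul, e1, e2, mul_comm,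
      ← smul_tmul_of, reassoc_smul, out_mk, pull_tmul]

theorem ev_reassoc {Q : Type u} [CommRing Q] {τ : R →+* Q} (e : Q →+* R)
    (h : e.comp τ = RingHom.id R)
    (hc : (RingHom.id A).comp G.s = (G.s.comp e).comp τ)
    (h' : (Fib.lift (RingHom.id A) (G.s.comp e) hc).comp ((Fib.inl G.s τ).comp G.t) = G.t)
    (η : Along ((Fib.inl G.s τ).comp G.t) ⊗[R] W) :
    ev e h _ (reassoc G.t G.s τ W η) =
      Twist.mk G.t G.s W (pull W (Fib.lift (RingHom.id A) (G.s.comp e) hc) h' η) := by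
  induction η using induct_fib with
  | zero => simp
  | add x y hx hy => simp only [map_add, hx, hy]
  | tmul p d w =>
    have e1 := RingHom.congr_fun (Fib.lift_inl _ _ hc) p
    have e2 := RingHom.congr_fun (Fib.lift_inr _ _ hc) d
    simp only [RingHom.comp_apply, RingHom.id_apply] at e1 e2
    rw [reassoc_tmul, ev_tmul, pull_tmul, map_mul, e1, e2, smul_mk, smul_tmul_of, mul_comm]

end Cofree

/-- `W ⊗_R A` with its regular coaction. -/
def cofree (G : AffineGroupoid k R A) (W : Type u) [AddCommGroup W] [Module R W] : GModule G where
  V := Twist G.t G.s W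
  ρ := regular G W
  ρ_smul := regular_smul W
  counit ξ := by
    have hc : (RingHom.id A).comp G.s = (G.s.comp G.ε).comp G.t := by
      rw [RingHom.comp_assoc, G.ε_t]; rfl
    have h1 : (Fib.lift _ _ hc).comp G.Δ = RingHom.id A := G.conv_one
    rw [regular_apply, ev_reassoc W G.ε G.ε_t hc (by
      rw [← RingHom.comp_assoc, Fib.lift_inl]; rfl), pull_pull (h'' := by rw [h1]; rfl),
      pull_congr h1 (h' := rfl), pull_id, mk_out]
  coassoc ξ := by
    have hc := G.conv_t _ _ (Fib.inl_comp G.s G.t)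
    have h := lift_rmul (G := G) (Fib.inl G.s G.t) (Fib.inr G.s G.t) rfl rfl
      (Fib.inl_comp _ _).symm hc
    have e : rmul G (G.conv _ _ (Fib.inl_comp G.s G.t)) hc = rmul G G.Δ G.Δ_t := by
      congr 1
      exact conv_inl_inr
    rw [pull_regular, pull_regular, act_regular (W := W) (h' := by
      rw [← RingHom.comp_assoc, Fib.lift_inl, rmul_t]), pull_pull (h'' := by
      rw [h, rmul_t])]
    exact congrArg _ (pull_congr (h.trans e) _ _ _)

section Sub

variable (X : GModule G)

theorem flat_inl_t (hfl : G.IsFlat) : Module.Flat R (Along ((Fib.inl G.s G.t).comp G.t)) := by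
  have h1 : (Fib.inl G.s G.t).Flat := by
    have : Module.Flat R (Along G.t) := hfl.2
    have h2 : Module.Flat (Along G.s) (Along G.s ⊗[R] Along G.t) := inferInstance
    exact (RingHom.flat_algebraMap_iff (R := Along G.s)).mpr h2
  exact RingHom.Flat.comp hfl.2 h1

theorem lTensor_inj (hfl : G.IsFlat) (N : Submodule R X.V) : Function.Injective (LinearMap.lTensor (Along G.t) N.subtype) := by
  have : Module.Flat R (Along G.t) := hfl.2
  exact Module.Flat.lTensor_preserves_injective_linearMap _ N.injective_subtype

theorem lTensor_inj' (hfl : G.IsFlat) (N : Submodule R X.V) : Function.Injective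
    (LinearMap.lTensor (Along ((Fib.inl G.s G.t).comp G.t)) N.subtype) := by
  have := flat_inl_t hfl
  exact Module.Flat.lTensor_preserves_injective_linearMap _ N.injective_subtype

variable (hfl : G.IsFlat) (N : Submodule R X.V)
  (hN : ∀ v : N, ∃ z, LinearMap.lTensor (Along G.t) N.subtype z = X.ρ v)

/-- The restriction of the coaction to a stable submodule. -/
noncomputable def subρ : N →+ Along G.t ⊗[R] N :=
  AddMonoidHom.mk' (fun v => (hN v).choose) (fun v w => by
    apply lTensor_inj X hfl N
    rw [map_add, (hN _).choose_spec, (hN _).choose_spec, (hN _).choose_spec]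
    exact map_add X.ρ (v : X.V) w)

theorem subρ_spec (v : N) : LinearMap.lTensor (Along G.t) N.subtype (X.subρ hfl N hN v) = X.ρ v :=
  (hN v).choose_spec

theorem subρ_smul (r : R) (v : N) :
    X.subρ hfl N hN (r • v) = G.s r • X.subρ hfl N hN v := by
  apply lTensor_inj X hfl N
  rw [lTensor_smul, subρ_spec, subρ_spec]
  exact X.ρ_smul r v

/-- A submodule stable under the coaction is a representation, when `A` is flat over `R`. -/
noncomputable def sub : GModule G where
  V := N
  ρ := X.subρ hfl N hN
  ρ_smul := X.subρ_smul hfl N hN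
  counit v := by
    apply N.injective_subtype
    rw [← ev_lTensor, subρ_spec]
    exact X.counit v
  coassoc v := by
    apply lTensor_inj' X hfl N
    rw [G.lTensor_act (hf := X.subρ_spec hfl N hN) (hρ' := X.ρ_smul), lTensor_pull, lTensor_pull,
      subρ_spec]
    exact X.coassoc v

end Sub

end GModule

namespace AffineGroupoid

open Along Twist GModule

variable {k R A : Type u} [CommRing k] [CommRing R] [CommRing A] [Algebra k R]
  [Algebra k A] (G : AffineGroupoid k R A)

section Pairs

variable {E : Type u} [CommRing E] (h : G.DiagRing →+* E) (x : A →+* E)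
  (hx : h.comp G.diag.s = x.comp G.t)

theorem pair_t (hx : h.comp G.diag.s = x.comp G.t) : h.comp G.diag.t = x.comp G.t := by
  rw [← G.diag_s_eq_t, hx]

theorem inv_s (hx : h.comp G.diag.s = x.comp G.t) :
    (h.comp (G.diag.ι.comp G.π)).comp G.s = x.comp G.t := by
  have e : (G.diag.ι.comp G.π).comp G.s = G.diag.t := G.diag.ι_s
  rw [RingHom.comp_assoc, e, G.pair_t h x hx]

theorem inv_t (hx : h.comp G.diag.s = x.comp G.t) :
    (h.comp (G.diag.ι.comp G.π)).comp G.t = x.comp G.t := by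
  have e : (G.diag.ι.comp G.π).comp G.t = G.diag.s := G.diag.ι_t
  rw [RingHom.comp_assoc, e, hx]

/-- The point `h⁻¹ x` for composable points `h` of `G^Δ` and `x` of `G`. -/
def invMul : A →+* E := G.conv (h.comp (G.diag.ι.comp G.π)) x (G.inv_s h x hx)

theorem invMul_t : (G.invMul h x hx).comp G.t = x.comp G.t :=
  (G.conv_t _ _ _).trans (G.inv_t h x hx)

theorem invMul_s : (G.invMul h x hx).comp G.s = x.comp G.s := G.conv_s _ _ _

variable (W : GModule G.diag)

/-- The value `h ξ(h⁻¹ x)` at a composable pair `(h, x)` of the translate of `ξ ∈ W ⊗_R A`, seen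
as a function on `G`, for the given action of `G^Δ` on `W` and its regular action on `A`. -/
def translate : Twist G.t G.s W.V →ₗ[R] Twist (x.comp G.t) (x.comp G.s) W.V where
  toFun ξ := Twist.mk _ _ _ (G.diag.act W.ρ W.ρ_smul h hx (G.pair_t h x hx)
    (pull W.V (G.invMul h x hx) (G.invMul_t h x hx) (Twist.out G.t G.s W.V ξ)))
  map_add' ξ η := by simp only [map_add]
  map_smul' r ξ := by
    have e : G.invMul h x hx (G.s r) = x (G.s r) := RingHom.congr_fun (G.invMul_s h x hx) r
    rw [out_smul, pull_smul, PreGroupoid.act_smul, e]; rfl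

/-- The value `ξ(x)` of `ξ ∈ W ⊗_R A`, seen as a function on `G`, at a point `x`. -/
def value : Twist G.t G.s W.V →ₗ[R] Twist (x.comp G.t) (x.comp G.s) W.V where
  toFun ξ := Twist.mk _ _ _ (pull W.V x rfl (Twist.out G.t G.s W.V ξ))
  map_add' ξ η := by simp only [map_add]
  map_smul' r ξ := by rw [out_smul, pull_smul]; rfl

variable {Q : Type u} [CommRing Q] {τ : R →+* Q}

theorem value_reassoc
    (c : ((Fib.inl (x.comp G.s) τ).comp x).comp G.s = (Fib.inr (x.comp G.s) τ).comp τ)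
    (c' : (Fib.lift _ _ c).comp ((Fib.inl G.s τ).comp G.t) =
      (Fib.inl (x.comp G.s) τ).comp (x.comp G.t))
    (η : Along ((Fib.inl G.s τ).comp G.t) ⊗[R] W.V) :
    LinearMap.lTensor (Along τ) (G.value x W) (reassoc G.t G.s τ W.V η) =
      reassoc (x.comp G.t) (x.comp G.s) τ W.V (pull W.V (Fib.lift _ _ c) c' η) := by
  induction η using induct_fib with
  | zero => simp
  | add x y hx hy => simp only [map_add, hx, hy]
  | tmul p d w =>
    have e1 := RingHom.congr_fun (Fib.lift_inl _ _ c) p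
    have e2 := RingHom.congr_fun (Fib.lift_inr _ _ c) d
    simp only [RingHom.comp_apply] at e1 e2
    rw [reassoc_tmul, LinearMap.lTensor_tmul, pull_tmul, map_mul, e1, e2, reassoc_tmul]
    rfl

theorem translate_reassoc
    (c : ((Fib.inl (x.comp G.s) τ).comp (G.invMul h x hx)).comp G.s =
      (Fib.inr (x.comp G.s) τ).comp τ)
    (c' : (Fib.lift _ _ c).comp ((Fib.inl G.s τ).comp G.t) =
      (Fib.inl (x.comp G.s) τ).comp (x.comp G.t))
    (ha : ((Fib.inl (x.comp G.s) τ).comp h).comp G.diag.s =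
      (Fib.inl (x.comp G.s) τ).comp (x.comp G.t))
    (hb : ((Fib.inl (x.comp G.s) τ).comp h).comp G.diag.t =
      (Fib.inl (x.comp G.s) τ).comp (x.comp G.t))
    (η : Along ((Fib.inl G.s τ).comp G.t) ⊗[R] W.V) :
    LinearMap.lTensor (Along τ) (G.translate h x hx W) (reassoc G.t G.s τ W.V η) =
      reassoc (x.comp G.t) (x.comp G.s) τ W.V
        (G.diag.act W.ρ W.ρ_smul _ ha hb (pull W.V (Fib.lift _ _ c) c' η)) := by
  induction η using induct_fib with
  | zero => simp
  | add x y hx hy => simp only [map_add, hx, hy]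
  | tmul p d w =>
    have e1 := RingHom.congr_fun (Fib.lift_inl _ _ c) p
    have e2 := RingHom.congr_fun (Fib.lift_inr _ _ c) d
    simp only [RingHom.comp_apply] at e1 e2
    rw [reassoc_tmul, LinearMap.lTensor_tmul, pull_tmul, map_mul, e1, e2, PreGroupoid.act_tmul,
      ← pull_pull (x := h) (h := G.pair_t h x hx) (h' := rfl), reassoc_inl]
    rfl

theorem invMul_conv {F : Type u} [CommRing F] (l : E →+* F) (r : A →+* F)
    (cx : (l.comp x).comp G.s = r.comp G.t)
    (ci : (l.comp (G.invMul h x hx)).comp G.s = r.comp G.t) (g : E →+* F)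
    (g1 : g.comp h = l.comp h) (g2 : g.comp x = G.conv (l.comp x) r cx) :
    G.conv (l.comp (G.invMul h x hx)) r ci = g.comp (G.invMul h x hx) := by
  have i1 : g.comp (h.comp (G.diag.ι.comp G.π)) = l.comp (h.comp (G.diag.ι.comp G.π)) := by
    rw [← RingHom.comp_assoc, g1, RingHom.comp_assoc]
  have k1 : (l.comp (h.comp (G.diag.ι.comp G.π))).comp G.s = (l.comp x).comp G.t := by
    rw [RingHom.comp_assoc, G.inv_s h x hx]; rfl
  have k2 : (l.comp (h.comp (G.diag.ι.comp G.π))).comp G.s =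
      (G.conv (l.comp x) r cx).comp G.t := by rw [k1, G.conv_t]
  have e1 : g.comp (G.invMul h x hx) = G.conv (l.comp (h.comp (G.diag.ι.comp G.π)))
      (G.conv (l.comp x) r cx) k2 := by
    rw [invMul, G.comp_conv (h' := by rw [i1, g2]; exact k2)]
    exact G.conv_congr i1 g2 _ _
  have e2 : l.comp (G.invMul h x hx) = G.conv (l.comp (h.comp (G.diag.ι.comp G.π)))
      (l.comp x) k1 := G.comp_conv _ _ _ _ _
  rw [e1, ← G.conv_assoc _ _ _ k1 cx]
  exact G.conv_congr e2 rfl _ _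

theorem value_comp : ((Fib.inl (x.comp G.s) G.t).comp x).comp G.s =
    (Fib.inr (x.comp G.s) G.t).comp G.t := Fib.inl_comp _ _

theorem pair_comp (hx : h.comp G.diag.s = x.comp G.t) :
    ((Fib.inl (x.comp G.s) G.t).comp h).comp G.diag.s =
      (G.conv ((Fib.inl (x.comp G.s) G.t).comp x) (Fib.inr (x.comp G.s) G.t)
        (G.value_comp x)).comp G.t := by
  rw [G.conv_t, RingHom.comp_assoc, hx]; rfl

theorem translate_regular (ξ : Twist G.t G.s W.V)
    (hξ : G.translate h x hx W ξ = G.value x W ξ)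
    (cx : ((Fib.inl (x.comp G.s) G.t).comp x).comp G.s = (Fib.inr (x.comp G.s) G.t).comp G.t)
    (g : E →+* Fib (x.comp G.s) G.t)
    (g1 : g.comp h = (Fib.inl (x.comp G.s) G.t).comp h)
    (g2 : g.comp x = G.conv ((Fib.inl (x.comp G.s) G.t).comp x) (Fib.inr (x.comp G.s) G.t) cx) :
    LinearMap.lTensor (Along G.t) (G.translate h x hx W - G.value x W) (regular G W.V ξ) = 0 := by
  have hξ : G.diag.act W.ρ W.ρ_smul h hx (G.pair_t h x hx)
      (pull W.V (G.invMul h x hx) (G.invMul_t h x hx) (Twist.out G.t G.s W.V ξ)) =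
      pull W.V x rfl (Twist.out G.t G.s W.V ξ) := hξ
  have ci : ((Fib.inl (x.comp G.s) G.t).comp (G.invMul h x hx)).comp G.s =
      (Fib.inr (x.comp G.s) G.t).comp G.t := by
    rw [RingHom.comp_assoc, invMul_s, ← cx, RingHom.comp_assoc]
  have ha : ((Fib.inl (x.comp G.s) G.t).comp h).comp G.diag.s =
      (Fib.inl (x.comp G.s) G.t).comp (x.comp G.t) := by rw [RingHom.comp_assoc, hx]
  have hb : ((Fib.inl (x.comp G.s) G.t).comp h).comp G.diag.t =
      (Fib.inl (x.comp G.s) G.t).comp (x.comp G.t) := by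
    rw [RingHom.comp_assoc, G.pair_t h x hx]
  have gt : g.comp (x.comp G.t) = (Fib.inl (x.comp G.s) G.t).comp (x.comp G.t) := by
    rw [← RingHom.comp_assoc, g2, G.conv_t]; rfl
  have mx : (Fib.lift _ _ cx).comp G.Δ = g.comp x := g2.symm
  have mi : (Fib.lift _ _ ci).comp G.Δ = g.comp (G.invMul h x hx) :=
    G.invMul_conv h x hx _ _ cx ci g g1 g2
  have gxt : (g.comp x).comp G.t = (Fib.inl (x.comp G.s) G.t).comp (x.comp G.t) := gt
  have git : (g.comp (G.invMul h x hx)).comp G.t =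
      (Fib.inl (x.comp G.s) G.t).comp (x.comp G.t) := by
    rw [RingHom.comp_assoc, invMul_t, gt]
  have key := congrArg (pull W.V g gt) hξ
  rw [G.diag.pull_act (hfa := gt) (ha' := by rw [g1, ha]) (hb' := by rw [g1, hb]),
    pull_pull (h'' := git), pull_pull (h'' := gxt)] at key
  have hx' : (Fib.lift _ _ cx).comp ((Fib.inl G.s G.t).comp G.t) =
      (Fib.inl (x.comp G.s) G.t).comp (x.comp G.t) := by
    rw [← RingHom.comp_assoc, Fib.lift_inl]; rfl
  have hi : (Fib.lift _ _ ci).comp ((Fib.inl G.s G.t).comp G.t) =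
      (Fib.inl (x.comp G.s) G.t).comp (x.comp G.t) := by
    rw [← RingHom.comp_assoc, Fib.lift_inl, RingHom.comp_assoc, invMul_t]
  rw [LinearMap.lTensor_sub, LinearMap.sub_apply, sub_eq_zero, regular_apply,
    G.value_reassoc x W cx hx', G.translate_reassoc h x hx W ci hi ha hb]
  congr 1
  rw [pull_pull (h'' := by rw [mi, git]), pull_pull (h'' := by rw [mx, gxt]),
    pull_congr mx (h' := gxt), ← key, pull_congr mi (h' := git)]
  exact (G.diag.act_congr _ _ g1 _ _ _ _ _).symm

end Pairs

section

variable (W : GModule G.diag)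

/-- The submodule `(W ⊗_R A)^{G^Δ}` of invariants: the `ξ` with `h ξ(h⁻¹ x) = ξ(x)` for the
universal composable pair `(h, x)`, that is, `ξ ↦ ξ ⊗ 1` under the coaction of `O(G^Δ)` on
`W ⊗_R A` given by `w ⊗ g ↦ w₀ ⊗ w₁ ι(π(g₁)) ⊗ g₂`. -/
def indSubmodule : Submodule R (Twist G.t G.s W.V) :=
  LinearMap.eqLocus
    (G.translate (Fib.inl G.diag.s G.t) (Fib.inr G.diag.s G.t) (Fib.inl_comp _ _) W)
    (G.value (Fib.inr G.diag.s G.t) W)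

theorem ind_stable (hfl : G.IsFlat) (ξ : G.indSubmodule W) :
    ∃ z, LinearMap.lTensor (Along G.t) (G.indSubmodule W).subtype z = (cofree G W.V).ρ ξ.1 := by
  have : Module.Flat R (Along G.t) := hfl.2
  have hex : Function.Exact (G.indSubmodule W).subtype
      (G.translate (Fib.inl G.diag.s G.t) (Fib.inr G.diag.s G.t) (Fib.inl_comp _ _) W -
        G.value (Fib.inr G.diag.s G.t) W) := by
    intro y
    rw [LinearMap.sub_apply, sub_eq_zero, Submodule.coe_subtype, Subtype.range_coe]
    rfl
  have hx := Fib.inl_comp G.diag.s G.t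
  have cg := G.pair_comp _ _ hx
  exact (Module.Flat.lTensor_exact (Along G.t) hex _).mp
    (G.translate_regular _ _ hx W ξ.1 ξ.2 (G.value_comp _) (Fib.lift _ _ cg)
      (Fib.lift_inl _ _ _) (Fib.lift_inr _ _ _))

/-- The induced representation `Ind(W) = (W ⊗_R A)^{G^Δ}`, on which `G` acts through the regular
action on `A`. -/
noncomputable def indObj (hfl : G.IsFlat) : GModule G :=
  (cofree G W.V).sub hfl (G.indSubmodule W) (G.ind_stable W hfl)

end

theorem lmap_mem {W W' : GModule G.diag} (φ : W ⟶ W') (ξ : Twist G.t G.s W.V)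
    (hξ : ξ ∈ G.indSubmodule W) : lmap G.t G.s (Hom.f φ) ξ ∈ G.indSubmodule W' := by
  have hξ : G.diag.act W.ρ W.ρ_smul _ (Fib.inl_comp _ _) (G.pair_t _ _ (Fib.inl_comp _ _))
      (pull W.V _ (G.invMul_t _ _ (Fib.inl_comp _ _)) (Twist.out G.t G.s W.V ξ)) =
      pull W.V (Fib.inr G.diag.s G.t) rfl (Twist.out G.t G.s W.V ξ) := hξ
  have key := congrArg (LinearMap.lTensor _ (Hom.f φ)) hξ
  rw [G.diag.lTensor_act (hf := Hom.comm φ) (hρ' := W'.ρ_smul), lTensor_pull, lTensor_pull] at key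
  exact key

theorem indObj_ρ (hfl : G.IsFlat) (W : GModule G.diag) (ξ : (G.indObj W hfl).V) :
    LinearMap.lTensor (Along G.t) (G.indSubmodule W).subtype ((G.indObj W hfl).ρ ξ) =
      regular G W.V ξ.1 :=
  subρ_spec (cofree G W.V) hfl (G.indSubmodule W) (G.ind_stable W hfl) ξ

theorem regular_lmap {W W' : Type u} [AddCommGroup W] [Module R W] [AddCommGroup W'] [Module R W']
    (f : W →ₗ[R] W') (ξ : Twist G.t G.s W) :
    LinearMap.lTensor (Along G.t) (lmap G.t G.s f) (regular G W ξ) =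
      regular G W' (lmap G.t G.s f ξ) := by
  rw [regular_apply, regular_apply, reassoc_lmap, lTensor_pull]; rfl

/-- The map `Ind(W) → Ind(W')` induced by `φ : W → W'`, the restriction of `φ ⊗ id`. -/
noncomputable def indMap (hfl : G.IsFlat) {W W' : GModule G.diag} (φ : W ⟶ W') :
    G.indObj W hfl ⟶ G.indObj W' hfl where
  f := LinearMap.restrict (lmap G.t G.s (Hom.f φ)) (G.lmap_mem φ)
  comm v := by
    apply lTensor_inj (cofree G W'.V) hfl (G.indSubmodule W')
    have e : (G.indSubmodule W').subtype ∘ₗ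
        LinearMap.restrict (lmap G.t G.s (Hom.f φ)) (G.lmap_mem φ) =
        lmap G.t G.s (Hom.f φ) ∘ₗ (G.indSubmodule W).subtype := rfl
    have h1 := G.indObj_ρ hfl W' (LinearMap.restrict (lmap G.t G.s (Hom.f φ)) (G.lmap_mem φ) v)
    refine Eq.trans ?_ h1.symm
    refine (LinearMap.lTensor_comp_apply (Along G.t) (G.indSubmodule W').subtype
      (LinearMap.restrict (lmap G.t G.s (Hom.f φ)) (G.lmap_mem φ)) _).symm.trans ?_
    refine (LinearMap.congr_fun (congrArg (LinearMap.lTensor (Along G.t)) e) _).trans ?_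
    refine (LinearMap.lTensor_comp_apply (Along G.t) _ _ _).trans ?_
    exact (congrArg _ (G.indObj_ρ hfl W v)).trans (G.regular_lmap _ _)

/-- The induction functor from representations of `G^Δ` to representations of `G`. -/
noncomputable def ind (hfl : G.IsFlat) : GModule G.diag ⥤ GModule G where
  obj W := G.indObj W hfl
  map φ := G.indMap hfl φ
  map_id W := by
    apply GModule.hom_ext
    apply LinearMap.ext
    intro ξ
    apply Subtype.ext
    exact congrArg (fun f => f ξ.1) (LinearMap.lTensor_id (Along G.t) W.V)
  map_comp {W W' W''} φ ψ := by
    apply GModule.hom_ext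
    apply LinearMap.ext
    intro ξ
    apply Subtype.ext
    exact LinearMap.lTensor_comp_apply (Along G.t) (Hom.f ψ) (Hom.f φ) ξ.1

/-- The linear map `Ind(W) → W`, `w ⊗ g ↦ ε(g) w`. -/
noncomputable def indEval (W : GModule G.diag) : Twist G.t G.s W.V →ₗ[R] W.V where
  toFun ξ := ev G.ε G.ε_t W.V (Twist.out G.t G.s W.V ξ)
  map_add' ξ η := by simp only [map_add]
  map_smul' r ξ := by
    have : G.ε (G.s r) = r := RingHom.congr_fun G.ε_s r
    rw [out_smul, ev_smul, this]; rfl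

theorem indEval_reassoc (W : GModule G.diag) {Q : Type u} [CommRing Q] {τ : R →+* Q}
    (c : (τ.comp G.ε).comp G.s = (RingHom.id Q).comp τ)
    (c' : (Fib.lift _ _ c).comp ((Fib.inl G.s τ).comp G.t) = τ)
    (η : Along ((Fib.inl G.s τ).comp G.t) ⊗[R] W.V) :
    LinearMap.lTensor (Along τ) (G.indEval W) (reassoc G.t G.s τ W.V η) =
      pull W.V (Fib.lift _ _ c) c' η := by
  induction η using induct_fib with
  | zero => simp
  | add x y hx hy => simp only [map_add, hx, hy]
  | tmul p d w =>
    have e1 := RingHom.congr_fun (Fib.lift_inl _ _ c) p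
    have e2 := RingHom.congr_fun (Fib.lift_inr _ _ c) d
    simp only [RingHom.comp_apply, RingHom.id_apply] at e1 e2
    rw [reassoc_tmul, LinearMap.lTensor_tmul, pull_tmul, map_mul, e1, e2, ← tmul_smul_of]
    rfl

theorem indEval_comm (W : GModule G.diag) (ξ : Twist G.t G.s W.V) (hξ : ξ ∈ G.indSubmodule W) :
    LinearMap.lTensor (Along G.diag.t) (G.indEval W)
      (pull _ G.π G.diag_t.symm (regular G W.V ξ)) = W.ρ (G.indEval W ξ) := by
  have hξ : G.diag.act W.ρ W.ρ_smul _ (Fib.inl_comp _ _) (G.pair_t _ _ (Fib.inl_comp _ _))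
      (pull W.V _ (G.invMul_t _ _ (Fib.inl_comp _ _)) (Twist.out G.t G.s W.V ξ)) =
      pull W.V (Fib.inr G.diag.s G.t) rfl (Twist.out G.t G.s W.V ξ) := hξ
  have c : (G.diag.t.comp G.ε).comp G.s = (RingHom.id G.DiagRing).comp G.diag.t := by
    rw [RingHom.comp_assoc, G.ε_s]; rfl
  have cπ : (G.diag.t.comp G.ε).comp G.s = G.π.comp G.t := c
  have l1 : (Fib.lift _ _ c).comp ((Fib.inr G.s G.diag.t).comp G.π) = G.π := by
    rw [← RingHom.comp_assoc, Fib.lift_inr]; rfl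
  have l2 : (Fib.lift _ _ c).comp (rmul G G.π G.diag_t.symm) = G.π := by
    have h1 : G.π.comp (G.conv (G.t.comp G.ε) (RingHom.id A) _) = G.π.comp (RingHom.id A) :=
      congrArg (fun f => G.π.comp f) G.one_conv
    rw [G.comp_conv (h' := cπ)] at h1
    rw [rmul, G.comp_conv (h' := by rw [Fib.lift_inl, l1]; exact cπ)]
    exact (G.conv_congr (Fib.lift_inl _ _ c) l1 _ cπ).trans h1
  have d : (RingHom.id G.DiagRing).comp G.diag.s = G.π.comp G.t := G.diag_s_eq_t
  have m1 : (Fib.lift _ _ d).comp (Fib.inl G.diag.s G.t) = RingHom.id _ := Fib.lift_inl _ _ d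
  have m2 : (Fib.lift _ _ d).comp (Fib.inr G.diag.s G.t) = G.π := Fib.lift_inr _ _ d
  have m3 : (Fib.lift _ _ d).comp (G.invMul _ _ (Fib.inl_comp G.diag.s G.t)) =
      G.diag.t.comp G.ε := by
    have h1 : (G.diag.conv G.diag.ι (RingHom.id _) _).comp G.π =
        (G.diag.s.comp G.diag.ε).comp G.π := congrArg (fun f => f.comp G.π) G.diag.inv_conv
    have c1 : (G.diag.ι.comp G.π).comp G.s = ((RingHom.id _).comp G.π).comp G.t := G.diag.ι_s
    have h2 := (G.diag_conv_π _ _ _ c1).symm.trans h1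
    have i1 : (Fib.lift _ _ d).comp ((Fib.inl G.diag.s G.t).comp (G.diag.ι.comp G.π)) =
        G.diag.ι.comp G.π := by
      rw [← RingHom.comp_assoc, m1]; rfl
    rw [invMul, G.comp_conv (h' := by rw [i1, m2]; exact c1)]
    refine (G.conv_congr i1 m2 _ c1).trans (h2.trans ?_)
    rw [G.diag_s_eq_t, RingHom.comp_assoc]
    exact congrArg (fun f => G.diag.t.comp f) G.diagε_π
  have dt : (Fib.lift _ _ d).comp ((Fib.inr G.diag.s G.t).comp G.t) = G.diag.t := by
    rw [← RingHom.comp_assoc, m2, G.diag_t]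
  have et : (G.diag.t.comp G.ε).comp G.t = G.diag.t := by
    rw [RingHom.comp_assoc, G.ε_t]; rfl
  have key := congrArg (pull W.V (Fib.lift _ _ d) dt) hξ
  rw [G.diag.pull_act (hfa := dt) (ha' := by rw [m1, ← G.diag_s_eq_t]; rfl)
      (hb' := by rw [m1]; rfl),
    pull_pull (h'' := by rw [m3, et]), pull_pull (h'' := by rw [m2, G.diag_t]),
    pull_congr m3 (h' := et), pull_congr m2 (h' := G.diag_t.symm),
    pull_ev G.ε G.ε_t, PreGroupoid.act_tmul, one_smul, pull_congr m1 (h' := rfl), pull_id] at key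
  rw [pull_regular, G.indEval_reassoc W c (by rw [← RingHom.comp_assoc, Fib.lift_inl, et]),
    pull_pull (h'' := by rw [l2, G.diag_t]), pull_congr l2 (h' := G.diag_t.symm)]
  exact key.symm

/-- The canonical morphism `Ind(W) → W`, `w ⊗ g ↦ ε(g) w`, of representations of `G^Δ`. -/
noncomputable def indCounit (hfl : G.IsFlat) (W : GModule G.diag) :
    ((G.ind hfl).obj W).res ⟶ W where
  f := G.indEval W ∘ₗ (G.indSubmodule W).subtype
  comm ξ := by
    refine Eq.trans ?_ (G.indEval_comm W ξ.1 ξ.2)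
    refine (LinearMap.lTensor_comp_apply (Along G.diag.t) _ _ _).trans ?_
    refine congrArg _ ?_
    refine (lTensor_pull (G.indSubmodule W).subtype G.π G.diag_t.symm _).trans ?_
    exact congrArg _ (G.indObj_ρ hfl W ξ)

end AffineGroupoid

/-- A functor between categories of representations is faithfully exact if it is faithful and
preserves and reflects exactness: a sequence is exact if and only if its image is exact. -/
def GModule.FaithfullyExact {k R A B : Type u} [CommRing k] [CommRing R] [CommRing A] [CommRing B]
    [Algebra k R] [Algebra k A] [Algebra k B] {H : AffineGroupoid k R B} {G : AffineGroupoid k R A}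
    (F : GModule H ⥤ GModule G) : Prop :=
  F.Faithful ∧ ∀ {X Y Z : GModule H} (φ : X ⟶ Y) (ψ : Y ⟶ Z),
    GModule.IsExact φ ψ ↔ GModule.IsExact (F.map φ) (F.map ψ)

/-! Write S for Spec R. The theorem is faithfully flat descent along the map `anchor` : G → S ×_k S
(target, source), under which G is a torsor for the diagonal group G^Δ acting by left translation.

Transitivity makes this map faithfully flat (`IsTransitive.flat_anchor`,
`IsTransitive.faithfullyFlat_anchor`). For flatness, fix a point of S with values in a residue field
K of R. After a faithfully flat base change of S ×_k S, the two universal points of S are both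
joined to it by arrows. Multiplying by these arrows turns the fibre of G over the universal pair
into one that is pulled back from Spec K, where everything is flat; flatness then descends.
Surjectivity holds because G has a point over a faithfully flat cover of S ×_k S. Since k is a
field, the projections S ×_k S → S are flat, so s and t are flat; t is even faithfully flat, because
the counit ε is a retraction of it.

The invariants (W ⊗_R A)^{G^Δ} form a module over R ⊗_k R, not only over R, and the core is
`mulMap_bijective`: multiplication gives a natural isomorphism A ⊗_{R ⊗_k R} (W ⊗_R A)^{G^Δ} ≅ W ⊗_R
A. Invariants are a kernel, so by flatness the left side consists of the functions f(x, y) on pairs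
of arrows with the same source and target that are invariant in x. Such a function satisfies f(x, y)
= (x y⁻¹) f(y, y), so it is determined by its restriction to the diagonal, and that restriction can
be an arbitrary element of W ⊗_R A.

Both A over R through t and A over R ⊗_k R are faithfully flat. Hence a sequence of W's is exact iff
it is so after ⊗_R A, iff A ⊗_{R ⊗_k R} of the invariants is exact, iff the invariants are exact.
For faithfulness and for surjectivity of the counit, write 1 ⊗ w as a sum of products of elements of
A with invariants, and apply ε. -/

namespace AffineGroupoid

/-! ### Inverses and cancellation for points of the groupoid -/

section Points

variable {k R A C : Type u} [CommRing k] [CommRing R] [CommRing A] [Algebra k R] [Algebra k A]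
  [CommRing C] (G : AffineGroupoid k R A)

/-- The inverse of a `C`-valued point of `G`. -/
def inv (x : A →+* C) : A →+* C := x.comp G.ι

theorem inv_comp_s (x : A →+* C) : (G.inv x).comp G.s = x.comp G.t := by
  rw [inv, RingHom.comp_assoc, G.ι_s]

theorem inv_comp_t (x : A →+* C) : (G.inv x).comp G.t = x.comp G.s := by
  rw [inv, RingHom.comp_assoc, G.ι_t]

theorem comp_ε_s (u : R →+* C) : (u.comp G.ε).comp G.s = u := by
  rw [RingHom.comp_assoc, G.ε_s]; rfl

theorem comp_ε_t (u : R →+* C) : (u.comp G.ε).comp G.t = u := by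
  rw [RingHom.comp_assoc, G.ε_t]; rfl

/-- Composability already forces the object `u` to be the target of `x`. Leaving `u` free lets the
rule apply to any expression for that object. -/
theorem unit_conv (u : R →+* C) (x : A →+* C) (h : (u.comp G.ε).comp G.s = x.comp G.t) :
    G.conv (u.comp G.ε) x h = x := by
  have hu : u = x.comp G.t := by rw [← h, comp_ε_s]
  subst hu
  exact (G.comp_conv x (G.t.comp G.ε) (RingHom.id A) _ h).symm.trans
    (congrArg (fun f => x.comp f) G.one_conv)

theorem conv_unit (u : R →+* C) (x : A →+* C) (h : x.comp G.s = (u.comp G.ε).comp G.t) :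
    G.conv x (u.comp G.ε) h = x := by
  have hu : u = x.comp G.s := by rw [h, comp_ε_t]
  subst hu
  exact (G.comp_conv x (RingHom.id A) (G.s.comp G.ε) _ h).symm.trans
    (congrArg (fun f => x.comp f) G.conv_one)

theorem conv_inv_left (x : A →+* C) :
    G.conv (G.inv x) x (G.inv_comp_s x) = (x.comp G.s).comp G.ε :=
  (G.comp_conv x G.ι (RingHom.id A) _ (G.inv_comp_s x)).symm.trans
    (congrArg (fun f => x.comp f) G.inv_conv)

theorem conv_inv_right (x : A →+* C) :
    G.conv x (G.inv x) (G.inv_comp_t x).symm = (x.comp G.t).comp G.ε :=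
  (G.comp_conv x (RingHom.id A) G.ι _ (G.inv_comp_t x).symm).symm.trans
    (congrArg (fun f => x.comp f) G.conv_inv)

theorem inv_conv_cancel_left (x y : A →+* C) (h : x.comp G.s = y.comp G.t)
    (h' : (G.inv x).comp G.s = (G.conv x y h).comp G.t) :
    G.conv (G.inv x) (G.conv x y h) h' = y := by
  rw [← G.conv_assoc _ _ _ (G.inv_comp_s x) h,
    G.conv_congr (G.conv_inv_left x) rfl _ (by rw [comp_ε_s, h]), unit_conv]

theorem conv_inv_cancel_left (x y : A →+* C) (h : (G.inv x).comp G.s = y.comp G.t)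
    (h' : x.comp G.s = (G.conv (G.inv x) y h).comp G.t) :
    G.conv x (G.conv (G.inv x) y h) h' = y := by
  rw [← G.conv_assoc _ _ _ (G.inv_comp_t x).symm h,
    G.conv_congr (G.conv_inv_right x) rfl _ (by rw [comp_ε_s, ← h, inv_comp_s]), unit_conv]

theorem inv_conv_cancel_right (x y : A →+* C) (h : y.comp G.s = (G.inv x).comp G.t)
    (h' : (G.conv y (G.inv x) h).comp G.s = x.comp G.t) :
    G.conv (G.conv y (G.inv x) h) x h' = y := by
  rw [G.conv_assoc _ _ _ h (G.inv_comp_s x),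
    G.conv_congr rfl (G.conv_inv_left x) _ (by rw [comp_ε_t, h, inv_comp_t]), conv_unit]

/-- Two-sided multiplication x (x⁻¹ z y⁻¹) y cancels to z. It shows below that moving the fibres of
G along arrows of the base is reversible. -/
theorem conj_conj (x y z : A →+* C) (h₁ : (G.inv x).comp G.s = z.comp G.t)
    (h₂ : (G.conv (G.inv x) z h₁).comp G.s = (G.inv y).comp G.t)
    (h₃ : x.comp G.s = (G.conv (G.conv (G.inv x) z h₁) (G.inv y) h₂).comp G.t)
    (h₄ : (G.conv x (G.conv (G.conv (G.inv x) z h₁) (G.inv y) h₂) h₃).comp G.s = y.comp G.t) :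
    G.conv (G.conv x (G.conv (G.conv (G.inv x) z h₁) (G.inv y) h₂) h₃) y h₄ = z := by
  have h₅ : (G.conv (G.conv (G.inv x) z h₁) (G.inv y) h₂).comp G.s = y.comp G.t :=
    (G.conv_s x _ h₃).symm.trans h₄
  have h₆ : x.comp G.s = (G.conv (G.inv x) z h₁).comp G.t := by rw [h₃, G.conv_t]
  rw [G.conv_assoc _ _ _ h₃ h₅, G.conv_congr rfl (G.inv_conv_cancel_right y _ h₂ h₅) _ h₆,
    conv_inv_cancel_left]

end Points

/-! ### The map from G to S ×_k S and transport between its fibres -/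

section Anchor

variable {k R A C : Type u} [CommRing k] [CommRing R] [CommRing A] [Algebra k R] [Algebra k A]
  [CommRing C] (G : AffineGroupoid k R A)

theorem t_κ : G.t.comp (algebraMap k R) = G.s.comp (algebraMap k R) := by
  rw [G.t_algebraMap, G.s_algebraMap]

/-- The map `r ⊗ r' ↦ t(r) s(r')` from `R ⊗_k R` to `A`. -/
def anchor : Fib (algebraMap k R) (algebraMap k R) →+* A := Fib.lift G.t G.s G.t_κ

theorem anchor_inl : G.anchor.comp (Fib.inl _ _) = G.t := Fib.lift_inl _ _ _

theorem anchor_inr : G.anchor.comp (Fib.inr _ _) = G.s := Fib.lift_inr _ _ _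

theorem comp_anchor_eq {x : A →+* C} {ν : Fib (algebraMap k R) (algebraMap k R) →+* C}
    (ht : x.comp G.t = ν.comp (Fib.inl _ _)) (hs : x.comp G.s = ν.comp (Fib.inr _ _)) :
    x.comp G.anchor = ν := by
  apply Fib.hom_ext
  · rw [RingHom.comp_assoc, anchor_inl, ht]
  · rw [RingHom.comp_assoc, anchor_inr, hs]

theorem comp_t_of_anchor {x : A →+* C} {ν : Fib (algebraMap k R) (algebraMap k R) →+* C}
    (h : x.comp G.anchor = ν) : x.comp G.t = ν.comp (Fib.inl _ _) := by
  rw [← h, RingHom.comp_assoc, anchor_inl]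

theorem comp_s_of_anchor {x : A →+* C} {ν : Fib (algebraMap k R) (algebraMap k R) →+* C}
    (h : x.comp G.anchor = ν) : x.comp G.s = ν.comp (Fib.inr _ _) := by
  rw [← h, RingHom.comp_assoc, anchor_inr]

section Transport

variable {ν ν' : Fib (algebraMap k R) (algebraMap k R) →+* C} {x y : A →+* C}

theorem transport_aux₁ (hx : x.comp G.t = ν'.comp (Fib.inl _ _)) :
    ((Fib.inr G.anchor ν').comp (G.inv x)).comp G.s = (Fib.inl G.anchor ν').comp G.t := by
  rw [RingHom.comp_assoc, inv_comp_s, hx, G.comp_t_of_anchor (Fib.inl_comp G.anchor ν'),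
    RingHom.comp_assoc]

theorem transport_aux₂ (hx : x.comp G.t = ν'.comp (Fib.inl _ _))
    (hy : y.comp G.t = ν'.comp (Fib.inr _ _)) :
    (G.conv ((Fib.inr G.anchor ν').comp (G.inv x)) (Fib.inl G.anchor ν')
      (G.transport_aux₁ hx)).comp G.s = ((Fib.inr G.anchor ν').comp y).comp G.t := by
  rw [G.conv_s, RingHom.comp_assoc, hy, G.comp_s_of_anchor (Fib.inl_comp G.anchor ν'),
    RingHom.comp_assoc]

/-- Let `x : a → a'` and `y : b → b'` be points of `G`. The map `g ↦ x⁻¹ g y` from the scheme of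
points `b' → a'` of `G` to that of points `b → a`. -/
def transport (hxs : x.comp G.s = ν.comp (Fib.inl _ _)) (hxt : x.comp G.t = ν'.comp (Fib.inl _ _))
    (hys : y.comp G.s = ν.comp (Fib.inr _ _)) (hyt : y.comp G.t = ν'.comp (Fib.inr _ _)) :
    Fib G.anchor ν →+* Fib G.anchor ν' :=
  Fib.lift (G.conv _ _ (G.transport_aux₂ hxt hyt)) (Fib.inr G.anchor ν') (G.comp_anchor_eq
    (by rw [G.conv_t, G.conv_t, RingHom.comp_assoc, inv_comp_t, hxs, RingHom.comp_assoc])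
    (by rw [G.conv_s, RingHom.comp_assoc, hys, RingHom.comp_assoc]))

theorem transport_inr
    (hxs : x.comp G.s = ν.comp (Fib.inl _ _)) (hxt : x.comp G.t = ν'.comp (Fib.inl _ _))
    (hys : y.comp G.s = ν.comp (Fib.inr _ _)) (hyt : y.comp G.t = ν'.comp (Fib.inr _ _)) :
    (G.transport hxs hxt hys hyt).comp (Fib.inr _ _) = Fib.inr _ _ := Fib.lift_inr _ _ _

/-- Only this one composite is needed: it exhibits one fibre as a retract of the other, and flatness
passes to retracts. -/
theorem transport_transport
    (hxs : x.comp G.s = ν.comp (Fib.inl _ _)) (hxt : x.comp G.t = ν'.comp (Fib.inl _ _))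
    (hys : y.comp G.s = ν.comp (Fib.inr _ _)) (hyt : y.comp G.t = ν'.comp (Fib.inr _ _)) :
    (G.transport (x := G.inv x) (y := G.inv y) ((G.inv_comp_s x).trans hxt)
      ((G.inv_comp_t x).trans hxs) ((G.inv_comp_s y).trans hyt) ((G.inv_comp_t y).trans hys)).comp
      (G.transport hxs hxt hys hyt) = RingHom.id _ := by
  set F := G.transport (x := G.inv x) (y := G.inv y) ((G.inv_comp_s x).trans hxt)
      ((G.inv_comp_t x).trans hxs) ((G.inv_comp_s y).trans hyt) ((G.inv_comp_t y).trans hys)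
    with hF
  have h₁ : F.comp (Fib.inr _ _) = Fib.inr _ _ := G.transport_inr _ _ _ _
  have h₂ : F.comp (Fib.inl _ _) = _ := Fib.lift_inl _ _ _
  have hx : F.comp ((Fib.inr G.anchor ν').comp (G.inv x)) = (Fib.inr _ _).comp (G.inv x) := by
    rw [← RingHom.comp_assoc, h₁]
  have hy : F.comp ((Fib.inr G.anchor ν').comp y) = (Fib.inr _ _).comp y := by
    rw [← RingHom.comp_assoc, h₁]
  have c₁ : (F.comp ((Fib.inr G.anchor ν').comp (G.inv x))).comp G.s =
      (F.comp (Fib.inl G.anchor ν')).comp G.t :=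
    congrArg (fun f => F.comp f) (G.transport_aux₁ hxt)
  have c₂ : (F.comp (G.conv ((Fib.inr G.anchor ν').comp (G.inv x)) (Fib.inl G.anchor ν')
      (G.transport_aux₁ hxt))).comp G.s = (F.comp ((Fib.inr G.anchor ν').comp y)).comp G.t :=
    congrArg (fun f => F.comp f) (G.transport_aux₂ hxt hyt)
  have e₁ := G.comp_conv F _ _ (G.transport_aux₁ hxt) c₁
  -- A composition carries a proof of composability, so that proof is copied and rewritten along
  -- with the points before `conv_congr` replaces them.
  have c₁' := c₁
  rw [hx, h₂] at c₁'
  have e₂ := e₁.trans (G.conv_congr hx h₂ c₁ c₁')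
  have c₂' := c₂
  rw [e₂, hy] at c₂'
  apply Fib.hom_ext
  · rw [RingHom.comp_assoc, transport, Fib.lift_inl, G.comp_conv (h' := c₂),
      G.conv_congr e₂ hy c₂ c₂']
    exact G.conj_conj ((Fib.inr G.anchor ν).comp (G.inv x)) ((Fib.inr G.anchor ν).comp y)
      (Fib.inl G.anchor ν) _ _ _ _
  · rw [RingHom.comp_assoc, transport_inr, h₁]; rfl

end Transport

end Anchor

end AffineGroupoid

/-! ### Flatness and faithful flatness of ring maps and fibre products -/

theorem RingHom.FaithfullyFlat.of_comp {P Q T : Type u} [CommRing P] [CommRing Q] [CommRing T]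
    {f : P →+* Q} (g : Q →+* T) (hf : f.Flat) (hgf : (g.comp f).FaithfullyFlat) :
    f.FaithfullyFlat := by
  rw [RingHom.FaithfullyFlat.iff_flat_and_comap_surjective] at hgf ⊢
  refine ⟨hf, fun p => ?_⟩
  -- A prime of P lifts to T, and its contraction to Q is the required preimage.
  obtain ⟨q, hq⟩ := hgf.2 p
  exact ⟨PrimeSpectrum.comap g q, by rw [← PrimeSpectrum.comap_comp_apply, hq]⟩

theorem RingHom.FaithfullyFlat.id (P : Type u) [CommRing P] :
    (RingHom.id P).FaithfullyFlat := .of_bijective Function.bijective_id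

theorem RingHom.FaithfullyFlat.comp {P Q T : Type u} [CommRing P] [CommRing Q] [CommRing T]
    {f : P →+* Q} {g : Q →+* T} (hf : f.FaithfullyFlat) (hg : g.FaithfullyFlat) :
    (g.comp f).FaithfullyFlat := RingHom.FaithfullyFlat.stableUnderComposition f g hf hg

/-- The maps `i` and `r` are P-linear, so Q is a direct summand of the flat P-module T. -/
theorem RingHom.Flat.of_retract {P Q T : Type u} [CommRing P] [CommRing Q] [CommRing T]
    {f : P →+* Q} {f' : P →+* T} (i : Q →+* T) (r : T →+* Q) (hi : i.comp f = f')
    (hr : r.comp f' = f) (h : r.comp i = RingHom.id Q) (hf : f'.Flat) : f.Flat := by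
  algebraize [f, f']
  exact Module.Flat.of_retract
    (AlgHom.toLinearMap (⟨i, fun x => RingHom.congr_fun hi x⟩ : Q →ₐ[P] T))
    (AlgHom.toLinearMap (⟨r, fun x => RingHom.congr_fun hr x⟩ : T →ₐ[P] Q))
    (LinearMap.ext fun x => RingHom.congr_fun h x)

namespace Fib

variable {P Q T F : Type u} [CommRing P] [CommRing Q] [CommRing T] [Field F]

theorem flat_inl (f : P →+* Q) {g : P →+* T} (hg : g.Flat) : (inl f g).Flat := by
  have : Module.Flat P (Along g) := hg
  have h : Module.Flat (Along f) (Along f ⊗[P] Along g) := inferInstance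
  exact (RingHom.flat_algebraMap_iff (R := Along f)).mpr h

theorem faithfullyFlat_inl (f : P →+* Q) {g : P →+* T} (hg : g.FaithfullyFlat) :
    (inl f g).FaithfullyFlat := by
  have : Module.FaithfullyFlat P (Along g) := hg
  have h : Module.FaithfullyFlat (Along f) (Along f ⊗[P] Along g) := inferInstance
  exact (RingHom.faithfullyFlat_algebraMap_iff (R := Along f)).mpr h

/-- The swap of the two tensor factors and its inverse serve as the retract data, which reduces the
right inclusion to the left one. -/
theorem flat_inr_of_flat {f : P →+* Q} (g : P →+* T) (hf : f.Flat) : (inr f g).Flat :=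
  (flat_inl g hf).of_retract (lift (inr g f) (inl g f) (inl_comp g f).symm)
    (lift (inr f g) (inl f g) (inl_comp f g).symm) (lift_inr _ _ _) (lift_inl _ _ _)
    (hom_ext (by rw [RingHom.comp_assoc, lift_inl, lift_inr]; rfl)
      (by rw [RingHom.comp_assoc, lift_inr, lift_inl]; rfl))

theorem faithfullyFlat_inr {f : P →+* Q} (g : P →+* T) (hf : f.FaithfullyFlat) :
    (inr f g).FaithfullyFlat := by
  refine .of_comp (lift (inr g f) (inl g f) (inl_comp g f).symm) (flat_inr_of_flat g hf.flat) ?_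
  rw [lift_inr]
  exact faithfullyFlat_inl g hf

theorem flat_inl_of_flat_inr {f : P →+* Q} {g : P →+* T} (h : (inr f g).Flat) :
    (inl g f).Flat :=
  h.of_retract (lift (inr f g) (inl f g) (inl_comp f g).symm)
    (lift (inr g f) (inl g f) (inl_comp g f).symm) (lift_inl _ _ _) (lift_inr _ _ _)
    (hom_ext (by rw [RingHom.comp_assoc, lift_inl, lift_inr]; rfl)
      (by rw [RingHom.comp_assoc, lift_inr, lift_inl]; rfl))

/-- Descent of flatness: `inr f g` is the base change of `f` along the faithfully flat `g`. -/
theorem flat_of_flat_inr {f : P →+* Q} {g : P →+* T} (hg : g.FaithfullyFlat)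
    (h : (inr f g).Flat) : f.Flat := by
  have : Module.FaithfullyFlat P (Along g) := hg
  have : Module.Flat (Along g) (Along g ⊗[P] Along f) :=
    (RingHom.flat_algebraMap_iff (R := Along g)).mp (flat_inl_of_flat_inr h)
  exact Module.Flat.of_flat_tensorProduct P (Along f) (Along g)

theorem flat_of_field (f : F →+* Q) : f.Flat := by
  algebraize [f]
  exact (inferInstance : Module.Flat F Q)

theorem faithfullyFlat_of_field [Nontrivial Q] (f : F →+* Q) : f.FaithfullyFlat := by
  algebraize [f]
  exact (inferInstance : Module.FaithfullyFlat F Q)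

/-- A base change that factors through a field F is flat whatever `f` is: over F every algebra is
flat, and flatness survives the further base change to T. The proof identifies Q ⊗_P T with T ⊗_F (F
⊗_P Q), as far as a retract requires. -/
theorem flat_inr_comp (f : P →+* Q) (x : P →+* F) (y : F →+* T) : (inr f (y.comp x)).Flat := by
  have h₁ : ((inr y (inl x f)).comp (inr x f)).comp f = (inl y (inl x f)).comp (y.comp x) := by
    rw [RingHom.comp_assoc, ← inl_comp x f, ← RingHom.comp_assoc, ← inl_comp y (inl x f)]; rfl
  have h₂ : ((inr f (y.comp x)).comp y).comp x = (inl f (y.comp x)).comp f :=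
    (inl_comp f (y.comp x)).symm
  obtain ⟨u, h₃, h₄⟩ : ∃ u : Fib x f →+* Fib f (y.comp x),
      u.comp (inl x f) = (inr f (y.comp x)).comp y ∧ u.comp (inr x f) = inl f (y.comp x) :=
    ⟨lift _ _ h₂, lift_inl _ _ h₂, lift_inr _ _ h₂⟩
  have h₅ := lift_inl _ _ h₃.symm
  have h₆ := lift_inr _ _ h₃.symm
  refine RingHom.Flat.of_retract _ _ (lift_inr _ _ h₁) h₅ (hom_ext ?_ ?_)
    (flat_inl y (flat_of_field (inl x f)))
  · rw [RingHom.comp_assoc, lift_inl, ← RingHom.comp_assoc, h₆]; exact h₄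
  · rw [RingHom.comp_assoc, lift_inr]; exact h₅

end Fib

/-! ### Transitivity makes G faithfully flat over S ×_k S -/

namespace AffineGroupoid

variable {k R A : Type u} [Field k] [CommRing R] [CommRing A] [Algebra k R] [Algebra k A]
  (G : AffineGroupoid k R A)

/-- Points of a transitive groupoid exist locally, for points with values in any `k`-algebra. -/
theorem IsTransitive.exists_point {G : AffineGroupoid k R A} (hG : G.IsTransitive) {T : Type u}
    [CommRing T] (a b : R →+* T) (hab : a.comp (algebraMap k R) = b.comp (algebraMap k R)) :
    ∃ (W : Type u) (_ : CommRing W) (φ : T →+* W) (g : A →+* W), φ.FaithfullyFlat ∧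
      g.comp G.s = φ.comp a ∧ g.comp G.t = φ.comp b := by
  -- The two points agree on k, so they induce one k-algebra structure on T for which both are
  -- k-algebra maps.
  let : Algebra k T := (a.comp (algebraMap k R)).toAlgebra
  exact hG T ⟨a, fun _ => rfl⟩ ⟨b, fun x => (RingHom.congr_fun hab x).symm⟩

/-- Over a faithfully flat cover of S ×_k S, the pullback of G along the universal pair is
isomorphic to its pullback along a constant pair (x, x), where x is a point with values in a field.
-/
theorem IsTransitive.flat_anchor {G : AffineGroupoid k R A} (hG : G.IsTransitive) :
    G.anchor.Flat := by
  cases subsingleton_or_nontrivial R with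
  | inl h =>
    have : Subsingleton A := G.s.codomain_trivial
    algebraize [G.anchor]
    exact inferInstanceAs (Module.Flat _ A)
  | inr h =>
    obtain ⟨m, hm⟩ := Ideal.exists_maximal R
    let := Ideal.Quotient.field m
    set κ := algebraMap k R
    let x : R →+* R ⧸ m := Ideal.Quotient.mk m
    -- The ring K ⊗_k (R ⊗_k R), with K = R/m, carries both the fixed point x of S and the universal
    -- pair of points.
    let l := Fib.inl (x.comp κ) ((Fib.inl κ κ).comp κ)
    let r := Fib.inr (x.comp κ) ((Fib.inl κ κ).comp κ)
    have hlr : l.comp (x.comp κ) = r.comp ((Fib.inl κ κ).comp κ) := Fib.inl_comp _ _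
    have hr : r.FaithfullyFlat := Fib.faithfullyFlat_inr _ (Fib.faithfullyFlat_of_field _)
    -- Arrows from the fixed point x to the first universal point, over W₁, and then to the second
    -- one, over the further cover W₂.
    obtain ⟨W₁, _, φ₁, g₁, hφ₁, hs₁, ht₁⟩ := hG.exists_point (l.comp x)
      (r.comp (Fib.inl κ κ)) hlr
    obtain ⟨W₂, _, φ₂, g₂, hφ₂, hs₂, ht₂⟩ := hG.exists_point (φ₁.comp (l.comp x))
      (φ₁.comp (r.comp (Fib.inr κ κ))) (congrArg (fun f => φ₁.comp f) (hlr.trans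
        (congrArg (fun f => r.comp f) (Fib.inl_comp κ κ))))
    -- Over W₂, `ν` is the universal pair and `ν'` is the constant pair (x, x); the latter factors
    -- through the field K.
    let ν : Fib κ κ →+* W₂ := (φ₂.comp φ₁).comp r
    let ν' : Fib κ κ →+* W₂ := ((φ₂.comp φ₁).comp l).comp (Fib.lift x x rfl)
    have e₁ : ν'.comp (Fib.inl κ κ) = (φ₂.comp φ₁).comp (l.comp x) := by
      rw [RingHom.comp_assoc, Fib.lift_inl]; rfl
    have e₂ : ν'.comp (Fib.inr κ κ) = (φ₂.comp φ₁).comp (l.comp x) := by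
      rw [RingHom.comp_assoc, Fib.lift_inr]; rfl
    have s₁ : (φ₂.comp g₁).comp G.s = ν'.comp (Fib.inl κ κ) :=
      (congrArg (fun f => φ₂.comp f) hs₁).trans e₁.symm
    have t₁ : (φ₂.comp g₁).comp G.t = ν.comp (Fib.inl κ κ) :=
      congrArg (fun f => φ₂.comp f) ht₁
    have hν : ν.FaithfullyFlat := hr.comp (hφ₁.comp hφ₂)
    refine Fib.flat_of_flat_inr hν ?_
    -- The arrows found above start at x, whereas the transport from `ν` to `ν'` needs arrows ending
    -- there; hence the inverses.
    have := G.transport_transport (x := G.inv (φ₂.comp g₁)) (y := G.inv g₂) (ν := ν) (ν' := ν')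
      ((G.inv_comp_s _).trans t₁) ((G.inv_comp_t _).trans s₁)
      ((G.inv_comp_s _).trans ht₂) ((G.inv_comp_t _).trans (hs₂.trans e₂.symm))
    exact RingHom.Flat.of_retract _ _ (G.transport_inr _ _ _ _) (G.transport_inr _ _ _ _) this
      (Fib.flat_inr_comp _ _ _)

/-- Transitivity applied to the two projections gives a point of G over a cover of S ×_k S. The
covering map thus factors through `anchor`, which is therefore surjective on spectra. -/
theorem IsTransitive.faithfullyFlat_anchor {G : AffineGroupoid k R A} (hG : G.IsTransitive) :
    G.anchor.FaithfullyFlat := by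
  obtain ⟨W, _, φ, g, hφ, hs, ht⟩ := hG.exists_point (Fib.inr (algebraMap k R) (algebraMap k R))
    (Fib.inl _ _) (Fib.inl_comp _ _).symm
  refine RingHom.FaithfullyFlat.of_comp g hG.flat_anchor ?_
  rwa [G.comp_anchor_eq ht hs]

/-- Each of s and t is `anchor` after one of the inclusions R → R ⊗_k R, which is flat because k is
a field. -/
theorem IsTransitive.isFlat {G : AffineGroupoid k R A} (hG : G.IsTransitive) : G.IsFlat := by
  have h : (Fib.inl (algebraMap k R) (algebraMap k R)).Flat :=
    Fib.flat_inl _ (Fib.flat_of_field _)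
  have h' : (Fib.inr (algebraMap k R) (algebraMap k R)).Flat :=
    Fib.flat_inr_of_flat _ (Fib.flat_of_field _)
  exact ⟨G.anchor_inr ▸ h'.comp hG.flat_anchor, G.anchor_inl ▸ h.comp hG.flat_anchor⟩

/-- The section ε of t makes the flat map t surjective on spectra. -/
theorem IsTransitive.faithfullyFlat_t {G : AffineGroupoid k R A} (hG : G.IsTransitive) :
    G.t.FaithfullyFlat :=
  .of_comp G.ε hG.isFlat.2 (G.ε_t ▸ .id R)

end AffineGroupoid

/-! ### Twisted modules over a second base ring, to be used with R ⊗_k R -/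

/-- The module `P ⊗_R W`, regarded as a module over another ring `N` through a ring map `N → P`. -/
def TwistOver {R N P : Type u} [CommRing R] [CommRing N] [CommRing P] (e : R →+* P) (_q : N →+* P)
    (W : Type u) [AddCommGroup W] [Module R W] : Type u := Along e ⊗[R] W

namespace TwistOver

open Along

variable {R N P Q : Type u} [CommRing R] [CommRing N] [CommRing P] [CommRing Q] {e : R →+* P}
  {q : N →+* P} {W : Type u} [AddCommGroup W] [Module R W]

instance : AddCommGroup (TwistOver e q W) := inferInstanceAs (AddCommGroup (Along e ⊗[R] W))

instance : Module N (TwistOver e q W) := Module.compHom (Along e ⊗[R] W) q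

/-- The identity map. -/
def mk (e : R →+* P) (q : N →+* P) (W : Type u) [AddCommGroup W] [Module R W] :
    Along e ⊗[R] W →+ TwistOver e q W := AddMonoidHom.id _

/-- The identity map, backwards. -/
def out (e : R →+* P) (q : N →+* P) (W : Type u) [AddCommGroup W] [Module R W] :
    TwistOver e q W →+ Along e ⊗[R] W := AddMonoidHom.id _

theorem out_smul (r : N) (ξ : TwistOver e q W) : out e q W (r • ξ) = q r • out e q W ξ := rfl

theorem smul_mk (r : N) (ξ : Along e ⊗[R] W) : r • mk e q W ξ = mk e q W (q r • ξ) := rfl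

theorem out_mk (ξ : Along e ⊗[R] W) : out e q W (mk e q W ξ) = ξ := rfl

theorem mk_out (ξ : TwistOver e q W) : mk e q W (out e q W ξ) = ξ := rfl

/-- For fixed `w`, the `N`-linear map `p ↦ p ⊗ w`. -/
def left (e : R →+* P) (q : N →+* P) (w : W) : Along q →ₗ[N] TwistOver e q W where
  toFun p := mk e q W (of e (Along.out q p) ⊗ₜ w)
  map_add' p p' := by rw [map_add, map_add, TensorProduct.add_tmul, map_add]
  map_smul' _ _ := rfl

/-- The canonical map `(P ⊗_N Q) ⊗_R W → Q ⊗_N (P ⊗_R W)`, `(p ⊗ d) ⊗ w ↦ d ⊗ (p ⊗ w)`. -/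
def reassoc (e : R →+* P) (q : N →+* P) (τ : N →+* Q) (W : Type u) [AddCommGroup W] [Module R W] :
    Along ((Fib.inl q τ).comp e) ⊗[R] W →+ Along τ ⊗[N] TwistOver e q W :=
  TensorProduct.liftAddHom
    (AddMonoidHom.flip (AddMonoidHom.mk' (fun w =>
      (((TensorProduct.comm N (TwistOver e q W) (Along τ)).toLinearMap ∘ₗ
        LinearMap.rTensor (Along τ) (left e q w)).toAddMonoidHom :
          Fib q τ →+ Along τ ⊗[N] TwistOver e q W)) (fun w w' => by
        have : left e q (w + w') = left e q w + left e q w' := by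
          ext p
          change mk e q W (of e (Along.out q p) ⊗ₜ (w + w')) = _
          rw [TensorProduct.tmul_add, map_add]; rfl
        rw [this, LinearMap.rTensor_add, LinearMap.comp_add]; rfl)))
    (fun r z w => by
      change TensorProduct.comm N _ _ (LinearMap.rTensor (Along τ) (left e q w)
          (Fib.inl q τ (e r) * Along.out _ z)) =
        TensorProduct.comm N _ _ (LinearMap.rTensor (Along τ) (left e q (r • w)) (Along.out _ z))
      congr 1
      generalize (Along.out _ z : Fib q τ) = y
      induction y using TensorProduct.induction_on with
      | zero => simp
      | add y y' h h' => rw [mul_add, map_add, map_add, h, h']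
      | tmul p d =>
        rw [Fib.inl_apply, Algebra.TensorProduct.tmul_mul_tmul, one_mul,
          LinearMap.rTensor_tmul, LinearMap.rTensor_tmul]
        congr 1
        exact congrArg (mk e q W) (tmul_smul_of (b := e) (Along.out q p) r w).symm)

theorem reassoc_tmul (τ : N →+* Q) (p : P) (d : Q) (w : W) :
    reassoc e q τ W (of _ (Fib.inl q τ p * Fib.inr q τ d) ⊗ₜ w) =
      of τ d ⊗ₜ mk e q W (of e p ⊗ₜ w) := by
  rw [← Fib.tmul_eq]; rfl

/-- The canonical map `Q ⊗_N (P ⊗_R W) → (P ⊗_N Q) ⊗_R W`, `d ⊗ ξ ↦ d ξ`. -/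
def expand (e : R →+* P) (q : N →+* P) (τ : N →+* Q) (W : Type u) [AddCommGroup W] [Module R W] :
    Along τ ⊗[N] TwistOver e q W →+ Along ((Fib.inl q τ).comp e) ⊗[R] W :=
  TensorProduct.liftAddHom
    (AddMonoidHom.mk' (fun d => AddMonoidHom.mk' (fun ξ =>
        Fib.inr q τ (Along.out τ d) • pull W (Fib.inl q τ) rfl (out e q W ξ))
      (fun ξ η => by rw [map_add, map_add, smul_add])) (fun c d => by
        ext ξ
        change Fib.inr q τ (Along.out τ (c + d)) • pull W (Fib.inl q τ) rfl (out e q W ξ) = _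
        rw [map_add, map_add, add_smul]; rfl))
    (fun r d ξ => by
      change Fib.inr q τ (τ r * Along.out τ d) • pull W (Fib.inl q τ) rfl (out e q W ξ) =
        Fib.inr q τ (Along.out τ d) • pull W (Fib.inl q τ) rfl (out e q W (r • ξ))
      have : Fib.inl q τ (q r) = Fib.inr q τ (τ r) := RingHom.congr_fun (Fib.inl_comp q τ) r
      rw [out_smul, pull_smul, this, smul_smul, map_mul, mul_comm])

theorem expand_tmul (τ : N →+* Q) (d : Q) (ξ : TwistOver e q W) :
    expand e q τ W (of τ d ⊗ₜ ξ) = Fib.inr q τ d • pull W (Fib.inl q τ) rfl (out e q W ξ) := rfl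

/-- Together with `reassoc_expand`, this identifies Q ⊗_N (P ⊗_R W) with (P ⊗_N Q) ⊗_R W. An element
of a base-changed module can then be read as a W-valued function on a fibre product. -/
theorem expand_reassoc (τ : N →+* Q) (η : Along ((Fib.inl q τ).comp e) ⊗[R] W) :
    expand e q τ W (reassoc e q τ W η) = η := by
  induction η using induct with
  | zero => simp
  | add x y hx hy => simp only [map_add, hx, hy]
  | tmul z w =>
    induction z using TensorProduct.induction_on with
    | zero => rw [map_zero, TensorProduct.zero_tmul, map_zero, map_zero]
    | add x y hx hy => simp only [map_add, TensorProduct.add_tmul, hx, hy]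
    | tmul p d =>
      have h := reassoc_tmul (e := e) (q := q) τ (Along.out q p) (Along.out τ d) w
      rw [← Fib.tmul_eq, of_out, of_out] at h
      rw [h, ← of_out τ d, expand_tmul, out_mk, pull_tmul, smul_tmul_of, mul_comm, ← Fib.tmul_eq]
      rfl

theorem reassoc_expand (τ : N →+* Q) (z : Along τ ⊗[N] TwistOver e q W) :
    reassoc e q τ W (expand e q τ W z) = z := by
  induction z using induct with
  | zero => simp
  | add x y hx hy => simp only [map_add, hx, hy]
  | tmul d ξ =>
    rw [expand_tmul, ← mk_out (q := q) ξ, out_mk]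
    generalize out e q W ξ = ζ
    induction ζ using induct with
    | zero => simp
    | add x y hx hy => simp only [map_add, smul_add, TensorProduct.tmul_add, hx, hy]
    | tmul p w => rw [pull_tmul, smul_tmul_of, mul_comm, reassoc_tmul]

theorem expand_injective (τ : N →+* Q) : Function.Injective (expand e q τ W) :=
  Function.LeftInverse.injective (reassoc_expand τ)

/-- Functoriality in `W`. -/
def lmap (e : R →+* P) (q : N →+* P) {W' : Type u} [AddCommGroup W'] [Module R W']
    (f : W →ₗ[R] W') : TwistOver e q W →ₗ[N] TwistOver e q W' where
  toFun ξ := mk e q W' (LinearMap.lTensor (Along e) f (out e q W ξ))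
  map_add' ξ η := by simp only [map_add]
  map_smul' r ξ := by rw [out_smul, lTensor_smul, ← smul_mk]; rfl

end TwistOver

/-! ### Functoriality of the action of points -/

namespace GModule

open Along

variable {k R A C : Type u} [CommRing k] [CommRing R] [CommRing A] [Algebra k R]
  [Algebra k A] [CommRing C] {G : AffineGroupoid k R A} (X : GModule G)

/-- By C-linearity of the action this reduces to elements 1 ⊗ v, where it is the coassociativity
recorded in `act_pull`. -/
theorem act_act (x y : A →+* C) (h : x.comp G.s = y.comp G.t) {a b c : R →+* C}
    (hxs : x.comp G.s = b) (hxt : x.comp G.t = c) (hys : y.comp G.s = a) (hyt : y.comp G.t = b)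
    (hs : (G.conv x y h).comp G.s = a) (ht : (G.conv x y h).comp G.t = c)
    (ξ : Along a ⊗[R] X.V) :
    G.act X.ρ X.ρ_smul x hxs hxt (G.act X.ρ X.ρ_smul y hys hyt ξ) =
      G.act X.ρ X.ρ_smul (G.conv x y h) hs ht ξ := by
  induction ξ using induct with
  | zero => simp
  | add x y hx hy => simp only [map_add, hx, hy]
  | tmul d v =>
    rw [G.act_tmul, G.act_smul, X.act_pull x y h hxs hxt hyt ht, G.act_tmul]

theorem act_unit {a : R →+* C} (hs : (a.comp G.ε).comp G.s = a) (ht : (a.comp G.ε).comp G.t = a)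
    (ξ : Along a ⊗[R] X.V) : G.act X.ρ X.ρ_smul (a.comp G.ε) hs ht ξ = ξ := by
  induction ξ using induct with
  | zero => simp
  | add x y hx hy => simp only [map_add, hx, hy]
  | tmul d v => rw [G.act_tmul, pull_ev G.ε G.ε_t, X.counit, smul_tmul_of, mul_one]

end GModule

/-! ### The torsor structure: quotients x y⁻¹ of parallel arrows -/

namespace AffineGroupoid

open Along

variable {k R A C E : Type u} [CommRing k] [CommRing R] [CommRing A] [Algebra k R] [Algebra k A]
  [CommRing C] [CommRing E] (G : AffineGroupoid k R A)

section Difference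

variable (x y : A →+* C) (hxy : x.comp G.anchor = y.comp G.anchor)

theorem s_eq_of_anchor (hxy : x.comp G.anchor = y.comp G.anchor) :
    x.comp G.s = y.comp G.s := by
  rw [G.comp_s_of_anchor hxy, RingHom.comp_assoc, anchor_inr]

theorem t_eq_of_anchor (hxy : x.comp G.anchor = y.comp G.anchor) :
    x.comp G.t = y.comp G.t := by
  rw [G.comp_t_of_anchor hxy, RingHom.comp_assoc, anchor_inl]

theorem diff_aux (hxy : x.comp G.anchor = y.comp G.anchor) :
    x.comp G.s = (G.inv y).comp G.t := by rw [inv_comp_t, G.s_eq_of_anchor x y hxy]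

/-- The point `x y⁻¹` of `G^Δ` for two points `x`, `y` of `G` with the same source and target. -/
def diff : G.DiagRing →+* C :=
  G.diagLift (G.conv x (G.inv y) (G.diff_aux x y hxy))
    (by rw [G.conv_s, G.conv_t, inv_comp_s, G.t_eq_of_anchor x y hxy])

theorem diff_π : (G.diff x y hxy).comp G.π = G.conv x (G.inv y) (G.diff_aux x y hxy) :=
  G.diagLift_π _ _

theorem diff_t : (G.diff x y hxy).comp G.diag.t = x.comp G.t := by
  rw [diag_t, ← RingHom.comp_assoc, diff_π, G.conv_t]

theorem diff_s : (G.diff x y hxy).comp G.diag.s = x.comp G.t := by rw [diag_s_eq_t, diff_t]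

theorem comp_diff (f : C →+* E) (h : (f.comp x).comp G.anchor = (f.comp y).comp G.anchor) :
    f.comp (G.diff x y hxy) = G.diff (f.comp x) (f.comp y) h := by
  apply G.diag_ext
  rw [RingHom.comp_assoc, diff_π, diff_π,
    G.comp_conv (h' := congrArg (fun g => f.comp g) (G.diff_aux x y hxy))]
  rfl

theorem diff_self (h : x.comp G.anchor = x.comp G.anchor) :
    G.diff x x h = (x.comp G.t).comp G.diag.ε := by
  apply G.diag_ext
  rw [diff_π, conv_inv_right]
  exact (congrArg (fun f => (x.comp G.t).comp f) G.diagε_π).symm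

end Difference

section Pairs

variable (h : G.DiagRing →+* C) (x y : A →+* C) (hx : h.comp G.diag.s = x.comp G.t)

theorem comp_diag_ι : h.comp (G.diag.ι.comp G.π) = G.inv (h.comp G.π) :=
  congrArg (fun f => h.comp f) G.diagι_π

theorem invMul_eq (c : (G.inv (h.comp G.π)).comp G.s = x.comp G.t) :
    G.invMul h x hx = G.conv (G.inv (h.comp G.π)) x c :=
  G.conv_congr (G.comp_diag_ι h) rfl _ _

/-- Left translation by G^Δ preserves the fibres of G → S ×_k S. This is what makes translation
linear over R ⊗_k R. -/
theorem invMul_anchor : (G.invMul h x hx).comp G.anchor = x.comp G.anchor :=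
  G.comp_anchor_eq (by rw [G.invMul_t, RingHom.comp_assoc, anchor_inl])
    (by rw [G.invMul_s, RingHom.comp_assoc, anchor_inr])

theorem comp_invMul (f : C →+* E) (c : (f.comp h).comp G.diag.s = (f.comp x).comp G.t) :
    f.comp (G.invMul h x hx) = G.invMul (f.comp h) (f.comp x) c := G.comp_conv _ _ _ _ _

/-- The identity (x y⁻¹)⁻¹ x = y: translating by the quotient of two parallel arrows carries one to
the other, so G^Δ is transitive on each fibre of G over S ×_k S. -/
theorem invMul_diff (hxy : x.comp G.anchor = y.comp G.anchor)
    (c : (G.diff x y hxy).comp G.diag.s = x.comp G.t) :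
    G.invMul (G.diff x y hxy) x c = y := by
  have e : (G.diff x y hxy).comp G.π = _ := G.diff_π x y hxy
  have h₁ : (G.conv x (G.inv y) (G.diff_aux x y hxy)).comp G.s = y.comp G.t := by
    rw [G.conv_s, inv_comp_s]
  have h₂ := G.inv_conv_cancel_right y x (G.diff_aux x y hxy) h₁
  have c₁ : (G.inv (G.conv x (G.inv y) (G.diff_aux x y hxy))).comp G.s =
      (G.conv (G.conv x (G.inv y) (G.diff_aux x y hxy)) y h₁).comp G.t := by
    rw [inv_comp_s, G.conv_t, G.conv_t, G.conv_t]
  have c₂ : (G.inv ((G.diff x y hxy).comp G.π)).comp G.s = x.comp G.t := by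
    rw [e, inv_comp_s, G.conv_t]
  rw [G.invMul_eq _ _ _ c₂]
  exact (G.conv_congr (congrArg G.inv e) h₂.symm c₂ c₁).trans (G.inv_conv_cancel_left _ _ _ _)

/-- The cocycle rule h · ((h⁻¹ x) y⁻¹) = x y⁻¹, which will make (x, y) ↦ (x y⁻¹) ξ(y) invariant in
x. -/
theorem conv_diff (hxy : x.comp G.anchor = y.comp G.anchor)
    (hxy' : (G.invMul h x hx).comp G.anchor = y.comp G.anchor)
    (c : h.comp G.diag.s = (G.diff (G.invMul h x hx) y hxy').comp G.diag.t) :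
    G.diag.conv h (G.diff (G.invMul h x hx) y hxy') c = G.diff x y hxy := by
  have e := G.diff_π (G.invMul h x hx) y hxy'
  have hs : (h.comp G.π).comp G.s = x.comp G.t := hx
  have c₀ : (G.inv (h.comp G.π)).comp G.s = x.comp G.t := by
    rw [inv_comp_s, ← hx]; exact congrArg (fun f => h.comp f) G.diag_s_eq_t.symm
  have c₁ : (h.comp G.π).comp G.s = (G.invMul h x hx).comp G.t := by rw [invMul_t, hs]
  have c₂ : (h.comp G.π).comp G.s =
      (G.conv (G.invMul h x hx) (G.inv y) (G.diff_aux _ y hxy')).comp G.t := by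
    rw [G.conv_t, c₁]
  have c₃ : (h.comp G.π).comp G.s = ((G.diff (G.invMul h x hx) y hxy').comp G.π).comp G.t := by
    rw [e, c₂]
  have c₄ : (h.comp G.π).comp G.s = (G.conv (G.inv (h.comp G.π)) x c₀).comp G.t := by
    rw [G.conv_t, inv_comp_t]
  have e₂ : G.conv (h.comp G.π) (G.invMul h x hx) c₁ = x :=
    (G.conv_congr rfl (G.invMul_eq h x hx c₀) _ c₄).trans (G.conv_inv_cancel_left _ _ _ _)
  apply G.diag_ext
  refine (G.diag_conv_π _ _ _ c₃).trans ((G.conv_congr rfl e _ c₂).trans ?_)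
  refine (G.conv_assoc _ _ _ c₁ (G.diff_aux _ y hxy')).symm.trans ?_
  rw [diff_π]
  exact G.conv_congr e₂ rfl _ _

end Pairs

end AffineGroupoid

/-! ### W-valued functions of a pair of parallel arrows -/

namespace AffineGroupoid

open Along TwistOver

variable {k R A C E : Type u} [CommRing k] [CommRing R] [CommRing A] [Algebra k R] [Algebra k A]
  [CommRing C] [CommRing E] (G : AffineGroupoid k R A) (W : GModule G.diag)

section Linear

variable (h : G.DiagRing →+* E) (x : A →+* E) (hx : h.comp G.diag.s = x.comp G.t)

/-- `translate`, as a linear map over `R ⊗_k R`. -/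
def translateOver : TwistOver G.t G.anchor W.V →ₗ[Fib (algebraMap k R) (algebraMap k R)]
    TwistOver (x.comp G.t) (x.comp G.anchor) W.V where
  toFun ξ := TwistOver.mk _ _ _ (G.diag.act W.ρ W.ρ_smul h hx (G.pair_t h x hx)
    (pull W.V (G.invMul h x hx) (G.invMul_t h x hx) (TwistOver.out G.t G.anchor W.V ξ)))
  map_add' ξ η := by simp only [map_add]
  map_smul' r ξ := by
    have e : G.invMul h x hx (G.anchor r) = x (G.anchor r) :=
      RingHom.congr_fun (G.invMul_anchor h x hx) r
    rw [out_smul, pull_smul, PreGroupoid.act_smul, e]; rfl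

/-- `value`, as a linear map over `R ⊗_k R`. -/
def valueOver : TwistOver G.t G.anchor W.V →ₗ[Fib (algebraMap k R) (algebraMap k R)]
    TwistOver (x.comp G.t) (x.comp G.anchor) W.V where
  toFun ξ := TwistOver.mk _ _ _ (pull W.V x rfl (TwistOver.out G.t G.anchor W.V ξ))
  map_add' ξ η := by simp only [map_add]
  map_smul' r ξ := by rw [out_smul, pull_smul]; rfl

variable {Q : Type u} [CommRing Q] {τ : Fib (algebraMap k R) (algebraMap k R) →+* Q}

/-- Under `expand`, tensoring the evaluation at x with Q over R ⊗_k R is again evaluation at x, with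
the Q-variable carried along as a parameter. -/
theorem expand_valueOver
    (c : ((Fib.inl (x.comp G.anchor) τ).comp x).comp G.anchor =
      (Fib.inr (x.comp G.anchor) τ).comp τ)
    (c' : (Fib.lift _ _ c).comp ((Fib.inl G.anchor τ).comp G.t) =
      (Fib.inl (x.comp G.anchor) τ).comp (x.comp G.t))
    (z : Along τ ⊗[Fib (algebraMap k R) (algebraMap k R)] TwistOver G.t G.anchor W.V) :
    expand (x.comp G.t) (x.comp G.anchor) τ W.V
        (LinearMap.lTensor (Along τ) (G.valueOver W x) z) =
      pull W.V (Fib.lift _ _ c) c' (expand G.t G.anchor τ W.V z) := by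
  induction z using induct with
  | zero => simp
  | add x y hx hy => simp only [map_add, hx, hy]
  | tmul d ξ =>
    have e := RingHom.congr_fun (Fib.lift_inr _ _ c) d
    rw [RingHom.comp_apply] at e
    have e' : ((Fib.inl (x.comp G.anchor) τ).comp x).comp G.t =
      (Fib.inl (x.comp G.anchor) τ).comp (x.comp G.t) := rfl
    have e'' : ((Fib.lift _ _ c).comp (Fib.inl G.anchor τ)).comp G.t =
      (Fib.inl (x.comp G.anchor) τ).comp (x.comp G.t) := c'
    rw [LinearMap.lTensor_tmul, expand_tmul, expand_tmul, pull_smul, e,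
      pull_pull (h'' := e''), pull_congr (Fib.lift_inl _ _ c) (h' := e')]
    exact congrArg _ (pull_pull _ _ _ _ e' _)

theorem pull_translateOver {F F' : Type u} [CommRing F] [CommRing F'] (l : E →+* F)
    (g : F' →+* F) (i : A →+* F') (hg : g.comp i = l.comp (G.invMul h x hx))
    (c : g.comp (i.comp G.t) = l.comp (x.comp G.t))
    (ha : (l.comp h).comp G.diag.s = l.comp (x.comp G.t))
    (hb : (l.comp h).comp G.diag.t = l.comp (x.comp G.t)) (ξ : TwistOver G.t G.anchor W.V) :
    pull W.V l rfl (TwistOver.out _ _ _ (G.translateOver W h x hx ξ)) =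
      G.diag.act W.ρ W.ρ_smul (l.comp h) ha hb
        (pull W.V g c (pull W.V i rfl (TwistOver.out _ _ _ ξ))) := by
  have c' : (l.comp (G.invMul h x hx)).comp G.t = l.comp (x.comp G.t) := by
    rw [RingHom.comp_assoc, invMul_t]
  rw [pull_pull (h'' := c), pull_congr hg (h' := c')]
  refine (G.diag.pull_act W.ρ W.ρ_smul h hx (G.pair_t h x hx) l rfl rfl ha hb _).trans ?_
  exact congrArg _ (pull_pull _ _ _ _ c' _)

/-- The analogue of `expand_valueOver` for translation: the group element acts on the arrow variable
and leaves the parameter in Q alone. -/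
theorem expand_translateOver
    (c : ((Fib.inl (x.comp G.anchor) τ).comp (G.invMul h x hx)).comp G.anchor =
      (Fib.inr (x.comp G.anchor) τ).comp τ)
    (c' : (Fib.lift _ _ c).comp ((Fib.inl G.anchor τ).comp G.t) =
      (Fib.inl (x.comp G.anchor) τ).comp (x.comp G.t))
    (ha : ((Fib.inl (x.comp G.anchor) τ).comp h).comp G.diag.s =
      (Fib.inl (x.comp G.anchor) τ).comp (x.comp G.t))
    (hb : ((Fib.inl (x.comp G.anchor) τ).comp h).comp G.diag.t =
      (Fib.inl (x.comp G.anchor) τ).comp (x.comp G.t))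
    (z : Along τ ⊗[Fib (algebraMap k R) (algebraMap k R)] TwistOver G.t G.anchor W.V) :
    expand (x.comp G.t) (x.comp G.anchor) τ W.V
        (LinearMap.lTensor (Along τ) (G.translateOver W h x hx) z) =
      G.diag.act W.ρ W.ρ_smul ((Fib.inl (x.comp G.anchor) τ).comp h) ha hb
        (pull W.V (Fib.lift _ _ c) c' (expand G.t G.anchor τ W.V z)) := by
  induction z using induct with
  | zero => simp
  | add x y hx hy => simp only [map_add, hx, hy]
  | tmul d ξ =>
    have e := RingHom.congr_fun (Fib.lift_inr _ _ c) d
    rw [RingHom.comp_apply] at e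
    rw [LinearMap.lTensor_tmul, expand_tmul, expand_tmul, pull_smul, e, PreGroupoid.act_smul]
    exact congrArg _ (G.pull_translateOver W h x hx _ _ _ (Fib.lift_inl _ _ c) c' ha hb ξ)

end Linear

/-- The value at a pair of points `(x, y)` with equal source and target of a `W`-valued function
`f` on the scheme of such pairs. -/
def valueAt (x y : A →+* C) (hxy : x.comp G.anchor = y.comp G.anchor) {b : R →+* C}
    (hb : x.comp G.t = b) :
    Along ((Fib.inl G.anchor G.anchor).comp G.t) ⊗[R] W.V →+ Along b ⊗[R] W.V :=
  (pull W.V (Fib.lift x y hxy)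
    (by rw [← RingHom.comp_assoc, Fib.lift_inl, hb])).toAddMonoidHom

theorem valueAt_apply (x y : A →+* C) (hxy : x.comp G.anchor = y.comp G.anchor) {b : R →+* C}
    (hb : x.comp G.t = b)
    (h : (Fib.lift x y hxy).comp ((Fib.inl G.anchor G.anchor).comp G.t) = b)
    (f : Along ((Fib.inl G.anchor G.anchor).comp G.t) ⊗[R] W.V) :
    G.valueAt W x y hxy hb f = pull W.V (Fib.lift x y hxy) h f := rfl

theorem valueAt_congr {x x' y y' : A →+* C} (ex : x = x') (ey : y = y')
    (hxy : x.comp G.anchor = y.comp G.anchor) (hxy' : x'.comp G.anchor = y'.comp G.anchor)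
    {b : R →+* C} (hb : x.comp G.t = b) (hb' : x'.comp G.t = b)
    (f : Along ((Fib.inl G.anchor G.anchor).comp G.t) ⊗[R] W.V) :
    G.valueAt W x y hxy hb f = G.valueAt W x' y' hxy' hb' f := by
  subst ex; subst ey; rfl

theorem pull_valueAt (g : C →+* E) (x y : A →+* C) (hxy : x.comp G.anchor = y.comp G.anchor)
    {b : R →+* C} (hb : x.comp G.t = b) {b' : R →+* E} (hg : g.comp b = b')
    (hxy' : (g.comp x).comp G.anchor = (g.comp y).comp G.anchor)
    (hb' : (g.comp x).comp G.t = b')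
    (f : Along ((Fib.inl G.anchor G.anchor).comp G.t) ⊗[R] W.V) :
    pull W.V g hg (G.valueAt W x y hxy hb f) = G.valueAt W (g.comp x) (g.comp y) hxy' hb' f := by
  have e := Fib.comp_lift g x y hxy hxy'
  have h₁ : (Fib.lift x y hxy).comp ((Fib.inl G.anchor G.anchor).comp G.t) = b := by
    rw [← RingHom.comp_assoc, Fib.lift_inl, hb]
  have h₂ : (g.comp (Fib.lift x y hxy)).comp ((Fib.inl G.anchor G.anchor).comp G.t) = b' := by
    rw [RingHom.comp_assoc, h₁, hg]
  rw [G.valueAt_apply W x y hxy hb h₁, pull_pull (h'' := h₂)]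
  exact pull_congr e _ _ _

/-- The function `(x, y) ↦ (x y⁻¹) ξ(y)` for `ξ ∈ W ⊗_R A`. -/
def spread (x y : A →+* C) (hxy : x.comp G.anchor = y.comp G.anchor) {b : R →+* C}
    (hb : x.comp G.t = b) : Along G.t ⊗[R] W.V →+ Along b ⊗[R] W.V :=
  (G.diag.act W.ρ W.ρ_smul (G.diff x y hxy) ((G.diff_s x y hxy).trans hb)
    ((G.diff_t x y hxy).trans hb)).comp
    (pull W.V y ((G.t_eq_of_anchor x y hxy).symm.trans hb)).toAddMonoidHom

theorem spread_apply (x y : A →+* C) (hxy : x.comp G.anchor = y.comp G.anchor) {b : R →+* C}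
    (hb : x.comp G.t = b) (ξ : Along G.t ⊗[R] W.V) :
    G.spread W x y hxy hb ξ = G.diag.act W.ρ W.ρ_smul (G.diff x y hxy)
      ((G.diff_s x y hxy).trans hb) ((G.diff_t x y hxy).trans hb)
      (pull W.V y ((G.t_eq_of_anchor x y hxy).symm.trans hb) ξ) := rfl

theorem spread_congr {x x' y y' : A →+* C} (ex : x = x') (ey : y = y')
    (hxy : x.comp G.anchor = y.comp G.anchor) (hxy' : x'.comp G.anchor = y'.comp G.anchor)
    {b : R →+* C} (hb : x.comp G.t = b) (hb' : x'.comp G.t = b) (ξ : Along G.t ⊗[R] W.V) :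
    G.spread W x y hxy hb ξ = G.spread W x' y' hxy' hb' ξ := by
  subst ex; subst ey; rfl

theorem pull_spread (g : C →+* E) (x y : A →+* C) (hxy : x.comp G.anchor = y.comp G.anchor)
    {b : R →+* C} (hb : x.comp G.t = b) {b' : R →+* E} (hg : g.comp b = b')
    (hxy' : (g.comp x).comp G.anchor = (g.comp y).comp G.anchor)
    (hb' : (g.comp x).comp G.t = b') (ξ : Along G.t ⊗[R] W.V) :
    pull W.V g hg (G.spread W x y hxy hb ξ) = G.spread W (g.comp x) (g.comp y) hxy' hb' ξ := by
  have e := G.comp_diff x y hxy g hxy'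
  rw [spread_apply, spread_apply, G.diag.pull_act (hfa := hg)
    (ha' := by rw [e, G.diff_s, hb']) (hb' := by rw [e, G.diff_t, hb']),
    pull_pull (h'' := (G.t_eq_of_anchor _ _ hxy').symm.trans hb')]
  exact G.diag.act_congr _ _ e _ _ _ _ _

/-- The two points of the universal pair over `G ×_{S × S} G` have the same source and target. -/
theorem pair_anchor : (Fib.inl G.anchor G.anchor).comp G.anchor =
    (Fib.inr G.anchor G.anchor).comp G.anchor := Fib.inl_comp _ _

/-- A function is recovered from its value at the universal pair, so identities between functions
may be checked on points. -/
theorem valueAt_univ (f : Along ((Fib.inl G.anchor G.anchor).comp G.t) ⊗[R] W.V) :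
    G.valueAt W _ _ G.pair_anchor rfl f = f := by
  have e : Fib.lift _ _ G.pair_anchor = RingHom.id (Fib G.anchor G.anchor) :=
    Fib.hom_ext (Fib.lift_inl _ _ _) (Fib.lift_inr _ _ _)
  exact (pull_congr e _ rfl f).trans (pull_id _ _)

/-- On the diagonal x x⁻¹ is a unit and acts trivially, so the function spread out from ξ restricts
to ξ. -/
theorem spread_self (x : A →+* C) (hxx : x.comp G.anchor = x.comp G.anchor)
    (ξ : Along G.t ⊗[R] W.V) :
    G.spread W x x hxx rfl ξ = pull W.V x rfl ξ := by
  have e := G.diff_self x hxx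
  have h := G.diff_s x x hxx
  have h' := G.diff_t x x hxx
  rw [e] at h h'
  rw [spread_apply]
  exact (G.diag.act_congr _ _ e _ _ h h' _).trans (W.act_unit h h' _)

/-- The invariance `h f(h⁻¹ x, y) = f(x, y)` of a function `f` of pairs `(x, y)`, at given points. -/
def IsInvariantAt (f : Along ((Fib.inl G.anchor G.anchor).comp G.t) ⊗[R] W.V)
    (h : G.DiagRing →+* C) (x y : A →+* C) (hx : h.comp G.diag.s = x.comp G.t)
    (hxy : x.comp G.anchor = y.comp G.anchor) : Prop :=
  G.diag.act W.ρ W.ρ_smul h hx (G.pair_t h x hx) (G.valueAt W (G.invMul h x hx) y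
    ((G.invMul_anchor h x hx).trans hxy) (G.invMul_t h x hx) f) = G.valueAt W x y hxy rfl f

theorem IsInvariantAt.comp {f : Along ((Fib.inl G.anchor G.anchor).comp G.t) ⊗[R] W.V}
    {h : G.DiagRing →+* C} {x y : A →+* C} {hx : h.comp G.diag.s = x.comp G.t}
    {hxy : x.comp G.anchor = y.comp G.anchor} (hf : G.IsInvariantAt W f h x y hx hxy)
    (u : C →+* E) (hx' : (u.comp h).comp G.diag.s = (u.comp x).comp G.t)
    (hxy' : (u.comp x).comp G.anchor = (u.comp y).comp G.anchor) :
    G.IsInvariantAt W f (u.comp h) (u.comp x) (u.comp y) hx' hxy' := by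
  have e := G.comp_invMul h x hx u hx'
  have ht := G.pair_t _ _ hx'
  have et := G.invMul_t _ _ hx'
  have ea := (G.invMul_anchor _ _ hx').trans hxy'
  have key := congrArg (pull W.V u (b := x.comp G.t) (b' := (u.comp x).comp G.t) rfl) hf
  rw [G.pull_valueAt W u x y hxy rfl rfl hxy' rfl f] at key
  refine Eq.trans ?_ key
  refine Eq.symm ((G.diag.pull_act W.ρ W.ρ_smul h hx _ u rfl rfl hx' ht _).trans (congrArg _ ?_))
  refine (G.pull_valueAt W u _ y _ _ rfl (by rw [e, ea]) (by rw [e, et]; rfl) f).trans ?_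
  exact G.valueAt_congr W e rfl _ _ _ _ f

/-- A function of pairs is invariant if it is so at all points. -/
def IsInvariant (f : Along ((Fib.inl G.anchor G.anchor).comp G.t) ⊗[R] W.V) : Prop :=
  ∀ (C : Type u) [CommRing C] (h : G.DiagRing →+* C) (x y : A →+* C)
    (hx : h.comp G.diag.s = x.comp G.t) (hxy : x.comp G.anchor = y.comp G.anchor),
    G.IsInvariantAt W f h x y hx hxy

/-- An invariant function is determined by its restriction to the diagonal. -/
theorem IsInvariant.eq_zero {f : Along ((Fib.inl G.anchor G.anchor).comp G.t) ⊗[R] W.V}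
    (hf : G.IsInvariant W f) (h0 : G.valueAt W (RingHom.id A) (RingHom.id A) rfl rfl f = 0) :
    f = 0 := by
  have hp := G.pair_anchor
  have c := G.diff_s _ _ hp
  have e := G.invMul_diff _ _ hp c
  -- Invariance with h = x y⁻¹ at the universal pair reads (x y⁻¹) f(y, y) = f(x, y), and f(y, y) is
  -- a pullback of the vanishing restriction to the diagonal.
  have key := hf _ (G.diff _ _ hp) _ _ c hp
  rw [IsInvariantAt] at key
  have ht := (G.t_eq_of_anchor _ _ hp).symm
  have hq := (G.pull_valueAt W (Fib.inr G.anchor G.anchor) (RingHom.id A) (RingHom.id A) rfl rfl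
    ht rfl ht f).symm.trans (congrArg _ h0)
  rw [G.valueAt_univ, G.valueAt_congr W e rfl _ rfl _ ht] at key
  rw [← key]
  exact (congrArg _ (hq.trans (map_zero _))).trans (map_zero _)

theorem isInvariant_spread (ξ : Along G.t ⊗[R] W.V) :
    G.IsInvariant W (G.spread W _ _ G.pair_anchor rfl ξ) := by
  intro C _ h x y hx hxy
  have hxy' := (G.invMul_anchor h x hx).trans hxy
  -- The target `b` is kept free because both x and h⁻¹ x must be inserted, and their targets agree
  -- only propositionally.
  have key : ∀ (x : A →+* C) (hxy : x.comp G.anchor = y.comp G.anchor) {b : R →+* C}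
      (hb : x.comp G.t = b),
      G.valueAt W x y hxy hb (G.spread W _ _ G.pair_anchor rfl ξ) = G.spread W x y hxy hb ξ := by
    intro x hxy b hb
    have e₁ := Fib.lift_inl x y hxy
    have e₂ := Fib.lift_inr x y hxy
    refine (G.pull_spread W (Fib.lift x y hxy) _ _ G.pair_anchor rfl _ (by rw [e₁, e₂, hxy])
      (by rw [e₁, hb]) ξ).trans ?_
    exact G.spread_congr W e₁ e₂ _ _ _ _ _
  have c : h.comp G.diag.s = (G.diff (G.invMul h x hx) y hxy').comp G.diag.t := by
    rw [G.diff_t, G.invMul_t, hx]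
  have e := G.conv_diff h x y hx hxy hxy' c
  rw [IsInvariantAt, key, key, spread_apply, spread_apply, W.act_act h _ c
    (hs := by rw [e, G.diff_s]) (ht := by rw [e, G.diff_t])]
  exact G.diag.act_congr _ _ e _ _ _ _ _

end AffineGroupoid

/-! ### Descent of invariants along G → S ×_k S -/

namespace AffineGroupoid

open Along TwistOver

section Descent

variable {k R A : Type u} [CommRing k] [CommRing R] [CommRing A] [Algebra k R] [Algebra k A]
  (G : AffineGroupoid k R A) (W : GModule G.diag)

/-- The invariants `(W ⊗_R A)^{G^Δ}` as a module over `R ⊗_k R`. -/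
def invariants : Submodule (Fib (algebraMap k R) (algebraMap k R))
    (TwistOver G.t G.anchor W.V) :=
  LinearMap.eqLocus
    (G.translateOver W (Fib.inl G.diag.s G.t) (Fib.inr G.diag.s G.t) (Fib.inl_comp _ _))
    (G.valueOver W (Fib.inr G.diag.s G.t))

section

variable {E : Type u} [CommRing E] (h : G.DiagRing →+* E) (x : A →+* E)
  (hx : h.comp G.diag.s = x.comp G.t)

theorem inl_anchor : ((Fib.inl (x.comp G.anchor) G.anchor).comp x).comp G.anchor =
    (Fib.inr (x.comp G.anchor) G.anchor).comp G.anchor := Fib.inl_comp _ _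

theorem inl_s (hx : h.comp G.diag.s = x.comp G.t) :
    ((Fib.inl (x.comp G.anchor) G.anchor).comp h).comp G.diag.s =
      ((Fib.inl (x.comp G.anchor) G.anchor).comp x).comp G.t := by
  rw [RingHom.comp_assoc, hx]; rfl

/-- After base change along `anchor`, with y as the new variable, the equation defining the
invariants becomes invariance in x of a function of (x, y). Injectivity of `expand` allows the two
sides to be compared as functions. -/
theorem lTensor_sub_eq_zero_iff (z : Along G.anchor ⊗[Fib (algebraMap k R) (algebraMap k R)]
      TwistOver G.t G.anchor W.V) :
    LinearMap.lTensor (Along G.anchor) (G.translateOver W h x hx - G.valueOver W x) z = 0 ↔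
      G.IsInvariantAt W (expand G.t G.anchor G.anchor W.V z) _ _ _ (G.inl_s h x hx)
        (G.inl_anchor x) := by
  have cx := G.inl_anchor x
  have ti : ((Fib.inl (x.comp G.anchor) G.anchor).comp (G.invMul h x hx)).comp G.t =
      (Fib.inl (x.comp G.anchor) G.anchor).comp (x.comp G.t) := by
    rw [RingHom.comp_assoc, invMul_t]
  have ci : ((Fib.inl (x.comp G.anchor) G.anchor).comp (G.invMul h x hx)).comp G.anchor =
      (Fib.inr (x.comp G.anchor) G.anchor).comp G.anchor := by
    rw [RingHom.comp_assoc, invMul_anchor]; exact Fib.inl_comp _ _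
  have cx' : (Fib.lift _ _ cx).comp ((Fib.inl G.anchor G.anchor).comp G.t) =
      (Fib.inl (x.comp G.anchor) G.anchor).comp (x.comp G.t) := by
    rw [← RingHom.comp_assoc, Fib.lift_inl]; rfl
  have ci' : (Fib.lift _ _ ci).comp ((Fib.inl G.anchor G.anchor).comp G.t) =
      (Fib.inl (x.comp G.anchor) G.anchor).comp (x.comp G.t) := by
    rw [← RingHom.comp_assoc, Fib.lift_inl, ti]
  have ha := G.inl_s h x hx
  have e := G.comp_invMul h x hx (Fib.inl (x.comp G.anchor) G.anchor) ha
  have e₁ := G.expand_translateOver W h x hx ci ci' ha (G.pair_t _ _ ha) z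
  have e₂ := G.expand_valueOver W x cx cx' z
  rw [LinearMap.lTensor_sub, LinearMap.sub_apply, sub_eq_zero]
  refine (expand_injective (e := x.comp G.t) (q := x.comp G.anchor) G.anchor).eq_iff.symm.trans
    (Eq.congr (e₁.trans (congrArg _ ?_)) e₂)
  exact G.valueAt_congr W e rfl ci _ ti _ _

end

/-- It suffices to test invariance on the universal triple (h, x, y), since every other triple is
its image under a ring map. -/
theorem isInvariant_iff (z : Along G.anchor ⊗[Fib (algebraMap k R) (algebraMap k R)]
      TwistOver G.t G.anchor W.V) :
    G.IsInvariant W (expand G.t G.anchor G.anchor W.V z) ↔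
      LinearMap.lTensor (Along G.anchor) (G.translateOver W (Fib.inl G.diag.s G.t)
        (Fib.inr G.diag.s G.t) (Fib.inl_comp _ _) - G.valueOver W (Fib.inr G.diag.s G.t)) z = 0 := by
  refine Iff.trans ?_ (G.lTensor_sub_eq_zero_iff W _ _ _ z).symm
  generalize expand G.t G.anchor G.anchor W.V z = f
  refine ⟨fun hf => hf _ _ _ _ _ _, fun hf C _ h x y hx hxy => ?_⟩
  obtain ⟨g, h₁, h₂⟩ : ∃ g : Fib G.diag.s G.t →+* C,
      g.comp (Fib.inl _ _) = h ∧ g.comp (Fib.inr _ _) = x :=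
    ⟨Fib.lift h x hx, Fib.lift_inl _ _ _, Fib.lift_inr _ _ _⟩
  have h₀ : g.comp ((Fib.inr G.diag.s G.t).comp G.anchor) = y.comp G.anchor := by
    rw [← RingHom.comp_assoc, h₂, hxy]
  obtain ⟨u, h₃, h₄⟩ : ∃ u : Fib ((Fib.inr G.diag.s G.t).comp G.anchor) G.anchor →+* C,
      u.comp (Fib.inl _ _) = g ∧ u.comp (Fib.inr _ _) = y :=
    ⟨Fib.lift g y h₀, Fib.lift_inl _ _ _, Fib.lift_inr _ _ _⟩
  subst h₃ h₁ h₂ h₄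
  exact IsInvariantAt.comp G W hf u hx hxy

variable {G}

/-- Invariants are the kernel of translation minus evaluation, and kernels commute with flat base
change. -/
theorem mem_range_iff_isInvariant (hG : G.anchor.Flat)
    (z : Along G.anchor ⊗[Fib (algebraMap k R) (algebraMap k R)] TwistOver G.t G.anchor W.V) :
    z ∈ Set.range (LinearMap.lTensor (Along G.anchor) (G.invariants W).subtype) ↔
      G.IsInvariant W (expand G.t G.anchor G.anchor W.V z) := by
  have : Module.Flat (Fib (algebraMap k R) (algebraMap k R)) (Along G.anchor) := hG
  have hex : Function.Exact (G.invariants W).subtype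
      (G.translateOver W (Fib.inl G.diag.s G.t) (Fib.inr G.diag.s G.t) (Fib.inl_comp _ _) -
        G.valueOver W (Fib.inr G.diag.s G.t)) := by
    intro y
    rw [LinearMap.sub_apply, sub_eq_zero, Submodule.coe_subtype, Subtype.range_coe]
    rfl
  rw [isInvariant_iff]
  exact (Module.Flat.lTensor_exact (Along G.anchor) hex z).symm

variable (G)

/-- The multiplication map `A ⊗_{R ⊗_k R} (W ⊗_R A)^{G^Δ} → W ⊗_R A`. -/
def mulMap : Along G.anchor ⊗[Fib (algebraMap k R) (algebraMap k R)] G.invariants W →+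
    Along G.t ⊗[R] W.V :=
  (G.valueAt W (RingHom.id A) (RingHom.id A) rfl rfl).comp
    ((expand G.t G.anchor G.anchor W.V).comp
      (LinearMap.lTensor (Along G.anchor) (G.invariants W).subtype).toAddMonoidHom)

theorem mulMap_apply
    (z : Along G.anchor ⊗[Fib (algebraMap k R) (algebraMap k R)] G.invariants W) :
    G.mulMap W z = G.valueAt W (RingHom.id A) (RingHom.id A) rfl rfl
      (expand G.t G.anchor G.anchor W.V
        (LinearMap.lTensor (Along G.anchor) (G.invariants W).subtype z)) := rfl

/-- On the diagonal a(y) ξ(x) becomes a ξ, so the map defined by restriction to the diagonal is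
indeed multiplication. -/
theorem mulMap_tmul (a : A) (m : G.invariants W) :
    G.mulMap W (of G.anchor a ⊗ₜ m) = a • TwistOver.out _ _ _ m.1 := by
  have e₁ : Fib.lift (RingHom.id A) (RingHom.id A) rfl (Fib.inr G.anchor G.anchor a) = a :=
    RingHom.congr_fun (Fib.lift_inr (RingHom.id A) (RingHom.id A) rfl) a
  have e₂ := Fib.lift_inl (RingHom.id A) (RingHom.id A) (rfl : (_ : RingHom _ _).comp G.anchor = _)
  have h : (Fib.lift (RingHom.id A) (RingHom.id A) rfl).comp
      ((Fib.inl G.anchor G.anchor).comp G.t) = G.t := by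
    rw [← RingHom.comp_assoc, e₂]; rfl
  rw [mulMap_apply, LinearMap.lTensor_tmul, expand_tmul, G.valueAt_apply _ _ _ _ _ h, pull_smul, e₁]
  exact congrArg _ (((pull_pull (Fib.lift (RingHom.id A) (RingHom.id A) rfl) (Fib.inl _ _) rfl h h
    _).trans (pull_congr e₂ h rfl _)).trans (pull_id _ _))

/-- Descent along the torsor `G → S ×_k S` under `G^Δ`. -/
theorem mulMap_bijective (hG : G.anchor.Flat) : Function.Bijective (G.mulMap W) := by
  have : Module.Flat (Fib (algebraMap k R) (algebraMap k R)) (Along G.anchor) := hG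
  constructor
  · rw [injective_iff_map_eq_zero]
    intro z hz
    have h₁ := IsInvariant.eq_zero G W ((mem_range_iff_isInvariant W hG _).mp ⟨z, rfl⟩) hz
    -- By flatness the inclusion of the invariants stays injective after tensoring, so it is enough
    -- that the associated function of pairs vanishes.
    apply Module.Flat.lTensor_preserves_injective_linearMap (M := Along G.anchor) _
      (G.invariants W).injective_subtype
    apply expand_injective G.anchor
    rw [h₁, map_zero, map_zero]
  · intro ξ
    -- The preimage of ξ comes from the function (x, y) ↦ (x y⁻¹) ξ(y): it is invariant, hence in
    -- the range, and equals ξ on the diagonal.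
    have h₁ := G.isInvariant_spread W ξ
    rw [← expand_reassoc G.anchor (G.spread W _ _ G.pair_anchor rfl ξ)] at h₁
    obtain ⟨z, hz⟩ := (mem_range_iff_isInvariant W hG _).mpr h₁
    refine ⟨z, ?_⟩
    have e₁ := Fib.lift_inl (RingHom.id A) (RingHom.id A)
      (rfl : (_ : RingHom _ _).comp G.anchor = _)
    have e₂ := Fib.lift_inr (RingHom.id A) (RingHom.id A)
      (rfl : (_ : RingHom _ _).comp G.anchor = _)
    rw [mulMap_apply, hz, expand_reassoc]
    refine (G.pull_spread W _ _ _ G.pair_anchor rfl (by rw [← RingHom.comp_assoc, e₁])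
      (by rw [e₁, e₂]) (by rw [e₁]) ξ).trans ?_
    refine (G.spread_congr W e₁ e₂ _ rfl _ rfl ξ).trans ?_
    rw [spread_self]
    exact pull_id _ ξ

theorem lmap_mem_invariants {W W' : GModule G.diag} (φ : W ⟶ W')
    (ξ : TwistOver G.t G.anchor W.V) (hξ : ξ ∈ G.invariants W) :
    TwistOver.lmap G.t G.anchor (GModule.Hom.f φ) ξ ∈ G.invariants W' := G.lmap_mem φ ξ hξ

/-- The map on invariants induced by a morphism, as a linear map over `R ⊗_k R`. -/
def invariantsMap {W W' : GModule G.diag} (φ : W ⟶ W') :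
    G.invariants W →ₗ[Fib (algebraMap k R) (algebraMap k R)] G.invariants W' :=
  LinearMap.restrict (TwistOver.lmap G.t G.anchor (GModule.Hom.f φ)) (G.lmap_mem_invariants φ)

theorem lTensor_mulMap {W W' : GModule G.diag} (φ : W ⟶ W')
    (z : Along G.anchor ⊗[Fib (algebraMap k R) (algebraMap k R)] G.invariants W) :
    LinearMap.lTensor (Along G.t) (GModule.Hom.f φ) (G.mulMap W z) =
      G.mulMap W' (LinearMap.lTensor (Along G.anchor) (G.invariantsMap φ) z) := by
  induction z using induct with
  | zero => simp
  | add x y hx hy => simp only [map_add, hx, hy]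
  | tmul a m => rw [mulMap_tmul, lTensor_smul, LinearMap.lTensor_tmul, mulMap_tmul]; rfl

/-- The isomorphisms `mulMap` are natural in the representation, so they form a ladder between the
two sequences. -/
theorem exact_lTensor_iff (hG : G.anchor.Flat) {X Y Z : GModule G.diag} (φ : X ⟶ Y) (ψ : Y ⟶ Z) :
    Function.Exact (LinearMap.lTensor (Along G.t) (GModule.Hom.f φ))
        (LinearMap.lTensor (Along G.t) (GModule.Hom.f ψ)) ↔
      Function.Exact (LinearMap.lTensor (Along G.anchor) (G.invariantsMap φ))
        (LinearMap.lTensor (Along G.anchor) (G.invariantsMap ψ)) := by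
  refine Function.Exact.iff_of_ladder_addEquiv
    (f₁₂ := (LinearMap.lTensor (Along G.anchor) (G.invariantsMap φ)).toAddMonoidHom)
    (f₂₃ := (LinearMap.lTensor (Along G.anchor) (G.invariantsMap ψ)).toAddMonoidHom)
    (g₁₂ := (LinearMap.lTensor (Along G.t) (GModule.Hom.f φ)).toAddMonoidHom)
    (g₂₃ := (LinearMap.lTensor (Along G.t) (GModule.Hom.f ψ)).toAddMonoidHom)
    (e₁ := AddEquiv.ofBijective _ (G.mulMap_bijective X hG))
    (e₂ := AddEquiv.ofBijective _ (G.mulMap_bijective Y hG))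
    (e₃ := AddEquiv.ofBijective _ (G.mulMap_bijective Z hG)) ?_ ?_
  · exact AddMonoidHom.ext fun z => G.lTensor_mulMap φ z
  · exact AddMonoidHom.ext fun z => G.lTensor_mulMap ψ z

/-- The two modules of invariants have the same underlying set and differ only in their scalars,
which exactness does not see. -/
theorem exact_invariantsMap_iff (hfl : G.IsFlat) {X Y Z : GModule G.diag} (φ : X ⟶ Y)
    (ψ : Y ⟶ Z) : Function.Exact (G.invariantsMap φ) (G.invariantsMap ψ) ↔
      GModule.IsExact ((G.ind hfl).map φ) ((G.ind hfl).map ψ) := Iff.rfl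

end Descent

/-! ### Faithful exactness of induction and surjectivity of the counit -/

variable {k R A : Type u} [Field k] [CommRing R] [CommRing A] [Algebra k R] [Algebra k A]
  {G : AffineGroupoid k R A}

theorem IsTransitive.isExact_ind_iff (hG : G.IsTransitive) {X Y Z : GModule G.diag} (φ : X ⟶ Y)
    (ψ : Y ⟶ Z) : GModule.IsExact φ ψ ↔
      GModule.IsExact ((G.ind hG.isFlat).map φ) ((G.ind hG.isFlat).map ψ) := by
  have : Module.FaithfullyFlat R (Along G.t) := hG.faithfullyFlat_t
  have : Module.FaithfullyFlat (Fib (algebraMap k R) (algebraMap k R)) (Along G.anchor) :=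
    hG.faithfullyFlat_anchor
  rw [← exact_invariantsMap_iff, ← Module.FaithfullyFlat.lTensor_exact_iff_exact _ (Along G.anchor),
    ← G.exact_lTensor_iff hG.flat_anchor]
  exact (Module.FaithfullyFlat.lTensor_exact_iff_exact R (Along G.t) _ _).symm

theorem IsTransitive.faithful_ind (hG : G.IsTransitive) : (G.ind hG.isFlat).Faithful where
  map_injective {X Y φ ψ} h := by
    have hm : G.invariantsMap φ = G.invariantsMap ψ :=
      LinearMap.ext fun ξ => LinearMap.congr_fun (congrArg GModule.Hom.f h) ξ
    apply GModule.hom_ext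
    apply LinearMap.ext
    intro w
    -- Since invariants generate A ⊗_R X over A, the maps φ and ψ agree after ⊗_R A as soon as they
    -- agree on invariants; evaluating with ε then recovers them on X.
    obtain ⟨z, hz⟩ := (G.mulMap_bijective X hG.flat_anchor).2 (of G.t 1 ⊗ₜ w)
    have key : LinearMap.lTensor (Along G.t) (GModule.Hom.f φ) (of G.t 1 ⊗ₜ w) =
        LinearMap.lTensor (Along G.t) (GModule.Hom.f ψ) (of G.t 1 ⊗ₜ w) := by
      rw [← hz, lTensor_mulMap, lTensor_mulMap, hm]
    have key' := congrArg (ev G.ε G.ε_t Y.V) key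
    rw [ev_lTensor, ev_lTensor, ev_tmul, map_one, one_smul] at key'
    exact key'

theorem IsTransitive.surjective_indCounit (hG : G.IsTransitive) (W : GModule G.diag) :
    Function.Surjective (GModule.Hom.f (G.indCounit hG.isFlat W)) := by
  intro w
  obtain ⟨z, hz⟩ := (G.mulMap_bijective W hG.flat_anchor).2 (of G.t 1 ⊗ₜ w)
  -- The value of ε on a product a m with m invariant is ε(a) times the counit at m, and the image
  -- of the counit is an R-submodule.
  have key : ∀ z, ev G.ε G.ε_t W.V (G.mulMap W z) ∈
      LinearMap.range (G.indEval W ∘ₗ (G.indSubmodule W).subtype) := by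
    intro z
    induction z using induct with
    | zero => simp
    | add x y hx hy => simpa only [map_add] using add_mem hx hy
    | tmul a m =>
      rw [mulMap_tmul, ev_smul]
      exact Submodule.smul_mem _ _ ⟨⟨m.1, m.2⟩, rfl⟩
  have h := key z
  rw [hz, ev_tmul, map_one, one_smul] at h
  exact h

end AffineGroupoid

theorem mainTheorem12 {k R A : Type u} [Field k] [CommRing R] [CommRing A] [Algebra k R]
    [Algebra k A] (G : AffineGroupoid k R A) (hG : G.IsTransitive) :
    ∃ hfl : G.IsFlat,
      GModule.FaithfullyExact (G.ind hfl) ∧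
        ∀ W : GModule G.diag, Function.Surjective (GModule.Hom.f (G.indCounit hfl W)) :=
  ⟨hG.isFlat, ⟨hG.faithful_ind, fun φ ψ => hG.isExact_ind_iff φ ψ⟩, hG.surjective_indCounit⟩
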